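/- Let $\sigma>0$, $\delta\ge 1$, $b\ge 0$, $p\in(0,1)$, and let $\lambda:[0,\infty)\to[0,\infty)$ be a continuous function in $H^{1,2}_{loc}([0,\infty))$, i.e. $\lambda f\in H^{1,2}([0,\infty))$ for every $f\in C_0^1([0,\infty))$, with weak derivative $\partial_t\lambda\in L^2_{loc}([0,\infty))$. Put $$\beta(t)=\lambda(0)-\int_0^t(\partial_t\lambda)^-(s)\,ds,\qquad \gamma(t)=\int_0^t(\partial_t\lambda)^+(s)\,ds ,$$ $$E=\{(t,x)\in[0,\infty)\times\mathbb R:\ x\ge-\gamma(t)\},$$ $$\rho(t,x)=\Big((1-p)\,\mathbb I_{[-\gamma(t),\beta(t))}(x)+p\,\mathbb I_{[\beta(t),\infty)}(x)\Big)\,|x+\gamma(t)|^{\delta-1}e^{-bx^2/2},$$ and assume that $\rho(s,x)\le\rho(t,x)$ whenever $0\le s\le t$ and $x\ge-\gamma(s)$. Let $m(dx\,dt)=\rho(t,x)\,dx\,dt$ on $E$ and $\mathcal H=L^2(E,m)$ with inner product $(\cdot,\cdot)$. Let $C_0^1(E)$ be the set of restrictions to $E$ of compactly supported $C^1$ functions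 on $\mathbb R^2$, and let $(\mathcal A,\mathcal V)$ be the closure in $\mathcal H$ of $$\mathcal A(F,G)=\frac{\sigma^2}{8}\int_E\partial_xF\,\partial_xG\,dm,\qquad F,G\in C_0^1(E),$$ where $\mathcal V$ carries the norm $(\mathcal A(F,F)+(F,F))^{1/2}$, and $\mathcal V'$ is its dual, with pairing $\langle\cdot,\cdot\rangle$; $\mathcal H$ is mapped to $\mathcal V'$ by $K\mapsto(K,\cdot)$. Let $(\partial_t,D(\partial_t,\mathcal H))$ be the generator on $\mathcal H$ of the contraction semigroup $U_tF(s,x)=F(s+t,x)$, and let $(\partial_t,\mathcal F)$ be the closure, as an operator from $\mathcal V$ to $\mathcal V'$, of the restriction of $\partial_t$ to $D(\partial_t,\mathcal H)\cap\mathcal V$. The time-dependent generalized Dirichlet form is $\mathcal E(F,G)=\mathcal A(F,G)-\langle\partial_tF,G\rangle$ for $F\in\mathcal F$, $G\in\mathcal V$. Then for every $\alpha>0$ and $f\in\mathcal H$ there is exactly one $G_\alpha f\in\mathcal F$ such that $$\mathcal E(G_\alpha f,v)+\alpha\,(G_\alpha f,v)=(f,v)\qquad\text{for all }v\in\mathcal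 V,$$ and the resolvent $(G_\alpha)_{\alpha>0}$ is Markovian: for every $\alpha>0$, if $f\in\mathcal H$ and $0\le f\le1$ $m$-a.e., then $0\le\alpha G_\alpha f\le1$ $m$-a.e., and $\alpha G_\alpha\mathbb I_E=\mathbb I_E$ $m$-a.e.; in particular $$G_1\mathbb I_E=\mathbb I_E\quad m\text{-a.e.}$$ Here $G_\alpha\mathbb I_E$ is understood through the monotone extension of $G_\alpha$: sequences $(f_n)$ in $\mathcal H$ with $0\le f_n\uparrow\mathbb I_E$ $m$-a.e. exist, and for each of them $\alpha G_\alpha f_n\uparrow\mathbb I_E$ $m$-a.e. -/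

import Mathlib

open MeasureTheory Set Filter Topology

namespace MovingDomain

noncomputable section

/-! ### One-dimensional Sobolev spaces on the closed half line `[0, ∞)` -/

/-- `u ∈ C_0^1(X)`: continuously differentiable with compact support. -/
def IsC01 {X : Type*} [NormedAddCommGroup X] [NormedSpace ℝ X] (u : X → ℝ) : Prop :=
  ContDiff ℝ 1 u ∧ HasCompactSupport u

/-- `φ ∈ H^{1,2}(ℝ⁺)`: `φ` is in the completion of (the restrictions to `[0, ∞)` of) `C_0^1(ℝ)`
with respect to the norm `(∫_{[0,∞)} |φ'|² + |φ|²)^{1/2}`, realised inside `L²([0, ∞))`. -/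
def MemH12 (φ : ℝ → ℝ) : Prop :=
  ∃ ψ : ℝ → ℝ, MemLp ψ 2 (volume.restrict (Ici (0 : ℝ))) ∧
    ∃ f : ℕ → ℝ → ℝ, (∀ n, IsC01 (f n)) ∧
      Tendsto (fun n => eLpNorm (fun x => f n x - φ x) 2 (volume.restrict (Ici (0 : ℝ))))
        atTop (𝓝 0) ∧
      Tendsto (fun n => eLpNorm (fun x => deriv (f n) x - ψ x) 2 (volume.restrict (Ici (0 : ℝ))))
        atTop (𝓝 0)

/-- `φ ∈ H^{1,2}_loc(ℝ⁺)`: `φ` is continuous on `[0, ∞)` and `φ f ∈ H^{1,2}(ℝ⁺)` for every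
`f ∈ C_0^1(ℝ⁺)`. -/
def MemH12loc (φ : ℝ → ℝ) : Prop :=
  ContinuousOn φ (Ici 0) ∧ ∀ f : ℝ → ℝ, IsC01 f → MemH12 (fun x => φ x * f x)

/-- `φ'` is the weak derivative of `φ` on `(0, ∞)`, and it lies in `L²_loc([0, ∞))`. -/
def IsWeakDerivL2loc (φ φ' : ℝ → ℝ) : Prop :=
  (∀ T : ℝ, MemLp φ' 2 (volume.restrict (Icc 0 T))) ∧
    ∀ f : ℝ → ℝ, IsC01 f → tsupport f ⊆ Ioi 0 →
      ∫ x in Ioi (0 : ℝ), φ x * deriv f x = - ∫ x in Ioi (0 : ℝ), φ' x * f x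

/-! ### The moving domain and its reference measure -/

/-- The data: the constants `σ, δ, b, p`, the curve `λ` and its weak derivative `∂ₜλ`
(all conditions on them are hypotheses of the theorem). -/
structure Data where
  sigma : ℝ
  delta : ℝ
  b : ℝ
  p : ℝ
  lam : ℝ → ℝ
  dlam : ℝ → ℝ

variable (c : Data)

/-- The decreasing part `β(t) = λ(0) - ∫₀ᵗ (∂ₜλ)⁻`. -/
def beta (t : ℝ) : ℝ := -(∫ s in (0 : ℝ)..t, max (-(c.dlam s)) 0) + c.lam 0

/-- The increasing part `γ(t) = ∫₀ᵗ (∂ₜλ)⁺`. -/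
def gamma (t : ℝ) : ℝ := ∫ s in (0 : ℝ)..t, max (c.dlam s) 0

/-- The moving domain `E = {(t, x) : t ≥ 0, x ≥ -γ(t)}`. -/
def dom : Set (ℝ × ℝ) := {y | 0 ≤ y.1 ∧ -(gamma c y.1) ≤ y.2}

/-- The density `ρ(t, x)`. -/
def rho (t x : ℝ) : ℝ :=
  ((1 - c.p) * (Ico (-(gamma c t)) (beta c t)).indicator (fun _ => (1 : ℝ)) x
      + c.p * (Ici (beta c t)).indicator (fun _ => (1 : ℝ)) x)
    * |x + gamma c t| ^ (c.delta - 1) * Real.exp (-(c.b * x ^ 2 / 2))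

/-- `ρ(s, x) ≤ ρ(t, x)` for all `0 ≤ s ≤ t` and `x ∈ E_s`. -/
def RhoMonotone : Prop :=
  ∀ s t x : ℝ, 0 ≤ s → s ≤ t → (s, x) ∈ dom c → rho c s x ≤ rho c t x

/-- The reference measure `m(dx dt) = ρ(t, x) dx dt` on `E`. -/
def refMeasure : Measure (ℝ × ℝ) :=
  (volume.restrict (dom c)).withDensity (fun y => ENNReal.ofReal (rho c y.1 y.2))

/-- `𝓗 = L²(E, m)`. -/
abbrev H : Type := Lp ℝ 2 (refMeasure c)

/-! ### The symmetric part `(𝓐, 𝓥)` -/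

/-- The graph of `∂ₓ` on `C_0^1(E)`: the pairs `(F, ∂ₓF)` of `m`-classes, where `F` is the
restriction to `E` of some `u ∈ C_0^1(ℝ²)`. -/
def gradGraph : Submodule ℝ (WithLp 2 (H c × H c)) where
  carrier := {v | ∃ u : ℝ × ℝ → ℝ, IsC01 u ∧ v.fst =ᵐ[refMeasure c] u ∧
    v.snd =ᵐ[refMeasure c] fun y => deriv (fun x => u (y.1, x)) y.2}
  zero_mem' := by
    refine ⟨fun _ => 0, ⟨contDiff_const, HasCompactSupport.zero⟩, ?_, ?_⟩
    · exact Lp.coeFn_zero ℝ 2 (refMeasure c)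
    · filter_upwards [Lp.coeFn_zero ℝ 2 (refMeasure c)] with y e
      simp only [WithLp.zero_snd]
      rw [e, Pi.zero_apply, deriv_const]
  add_mem' := by
    rintro v w ⟨u, hu, h1, h2⟩ ⟨u', hu', h1', h2'⟩
    have hd : ∀ {u : ℝ × ℝ → ℝ}, IsC01 u → ∀ y : ℝ × ℝ,
        DifferentiableAt ℝ (fun x => u (y.1, x)) y.2 := fun hu y =>
      ((hu.1.differentiable one_ne_zero).comp (by fun_prop :
        Differentiable ℝ (fun x : ℝ => (y.1, x)))) y.2
    refine ⟨fun y => u y + u' y, ⟨hu.1.add hu'.1, hu.2.add hu'.2⟩, ?_, ?_⟩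
    · filter_upwards [h1, h1', Lp.coeFn_add v.fst w.fst] with y a b e
      simp only [WithLp.add_fst]
      rw [e, Pi.add_apply, a, b]
    · filter_upwards [h2, h2', Lp.coeFn_add v.snd w.snd] with y a b e
      simp only [WithLp.add_snd]
      rw [e, Pi.add_apply, a, b]
      exact (deriv_fun_add (hd hu y) (hd hu' y)).symm
  smul_mem' := by
    rintro r v ⟨u, hu, h1, h2⟩
    have hd : ∀ y : ℝ × ℝ, DifferentiableAt ℝ (fun x => u (y.1, x)) y.2 := fun y =>
      ((hu.1.differentiable one_ne_zero).comp (by fun_prop :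
        Differentiable ℝ (fun x : ℝ => (y.1, x)))) y.2
    refine ⟨fun y => r * u y, ⟨contDiff_const.mul hu.1, hu.2.mul_left⟩, ?_, ?_⟩
    · filter_upwards [h1, Lp.coeFn_smul r v.fst] with y a e
      simp only [WithLp.smul_fst]
      rw [e, Pi.smul_apply, a, smul_eq_mul]
    · filter_upwards [h2, Lp.coeFn_smul r v.snd] with y a e
      simp only [WithLp.smul_snd]
      rw [e, Pi.smul_apply, a, smul_eq_mul]
      exact (deriv_const_mul r (hd y)).symm

/-- `𝓥`: the closure of `C_0^1(E)` for the norm `𝓐₁^{1/2}`. The norm is equivalent to the graph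
norm of `∂ₓ`, so an element of `𝓥` is a pair `(F, ∂ₓF)` in the closed graph of `∂ₓ` in
`𝓗 × 𝓗`. -/
def V : Submodule ℝ (WithLp 2 (H c × H c)) := (gradGraph c).topologicalClosure

/-- The embedding `𝓥 → 𝓗`. -/
def toH (v : V c) : H c := (v : WithLp 2 (H c × H c)).fst

/-- The spatial derivative `∂ₓ : 𝓥 → 𝓗`. -/
def dx (v : V c) : H c := (v : WithLp 2 (H c × H c)).snd

/-- `𝓐(F, G) = σ²/8 ∫ ∂ₓF ∂ₓG ρ dx ds` on `𝓥`. -/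
def formA (u v : V c) : ℝ := c.sigma ^ 2 / 8 * inner ℝ (dx c u) (dx c v)

/-! ### The time derivative -/

/-- The translation semigroup `U_t F(s, x) = F(s + t, x)`. For `t ≥ 0` it maps `E` into itself. -/
def shift (t : ℝ) (F : ℝ × ℝ → ℝ) : ℝ × ℝ → ℝ := fun y => F (y.1 + t, y.2)

/-- `F` is in the domain `D(∂ₜ, 𝓗)` of the generator of `(U_t)` on `𝓗` and `∂ₜF = K`:
`(U_t F - F) / t → K` in `L²(E, m)` as `t ↓ 0`. -/
def HasTimeDeriv (F K : H c) : Prop :=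
  Tendsto (fun t : ℝ => eLpNorm (fun y => (shift t F y - F y) / t - K y) 2 (refMeasure c))
    (𝓝[>] 0) (𝓝 0)

/-- The graph of `(∂ₜ, 𝓕)`, that is, of the closure, as an operator from `𝓥` to `𝓥'`, of
`∂ₜ : D(∂ₜ, 𝓗) ∩ 𝓥 → 𝓗 ⊆ 𝓥'`, where `K ∈ 𝓗` acts on `𝓥` by `w ↦ (K, w)_𝓗`. -/
def timeGraph : Set (V c × StrongDual ℝ (V c)) :=
  closure {q | ∃ K : H c, HasTimeDeriv c (toH c q.1) K ∧
    ∀ w : V c, q.2 w = inner ℝ K (toH c w)}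

/-! ### The generalized Dirichlet form and its resolvent -/

/-- `𝓔_α(u, v) = 𝓐(u, v) - ⟨∂ₜu, v⟩ + α (u, v)_𝓗` for `u ∈ 𝓕` with `∂ₜu = ℓ ∈ 𝓥'`, `v ∈ 𝓥`. -/
def formE (α : ℝ) (u : V c) (ℓ : StrongDual ℝ (V c)) (v : V c) : ℝ :=
  formA c u v - ℓ v + α * inner ℝ (toH c u) (toH c v)

/-- `g = G_α f`: `g` is an element of `𝓕` with `𝓔_α(g, v) = (f, v)_𝓗` for all `v ∈ 𝓥`. -/
def IsResolvent (α : ℝ) (f g : H c) : Prop :=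
  ∃ q ∈ timeGraph c, toH c q.1 = g ∧ ∀ v : V c, formE c α q.1 q.2 v = inner ℝ f (toH c v)

/-- The resolvent `G_α : 𝓗 → 𝓗` of the generalized Dirichlet form. -/
def resolvent (α : ℝ) (f : H c) : H c := Classical.epsilon (IsResolvent c α f)

/-- `T : 𝓗 → 𝓗` is sub-Markovian: `0 ≤ f ≤ 1` `m`-a.e. implies `0 ≤ T f ≤ 1` `m`-a.e. -/
def IsSubMarkovian (T : H c → H c) : Prop :=
  ∀ f : H c, (∀ᵐ y ∂refMeasure c, 0 ≤ f y ∧ f y ≤ 1) →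
    ∀ᵐ y ∂refMeasure c, 0 ≤ T f y ∧ T f y ≤ 1

/-- `(a n)` is a sequence in `𝓗` with `0 ≤ a n ↑ f` `m`-a.e. -/
def IncreasesTo (a : ℕ → H c) (f : ℝ × ℝ → ℝ) : Prop :=
  ∀ᵐ y ∂refMeasure c, (∀ n, 0 ≤ a n y) ∧ Monotone (fun n => a n y) ∧
    Tendsto (fun n => a n y) atTop (𝓝 (f y))

/-- `T f = g` `m`-a.e. for the monotone extension of `T : 𝓗 → 𝓗` to functions `f ≥ 0` that need not
be square integrable: there are sequences `0 ≤ a n ↑ f` in `𝓗`, and for each of them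
`T (a n) ↑ g` `m`-a.e. -/
def ExtendsTo (T : H c → H c) (f g : ℝ × ℝ → ℝ) : Prop :=
  (∃ a : ℕ → H c, IncreasesTo c a f) ∧
    ∀ a : ℕ → H c, IncreasesTo c a f →
      ∀ᵐ y ∂refMeasure c, Monotone (fun n => T (a n) y) ∧
        Tendsto (fun n => T (a n) y) atTop (𝓝 (g y))

/-- The function `𝟙_E`. -/
def oneE : ℝ × ℝ → ℝ := (dom c).indicator (fun _ => 1)

end

end MovingDomain

/-!
The monotonicity of `ρ` in `t` says that translation in time does not increase integrals, so `∂ₜ`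
is dissipative on `𝓗`. By Lions' theorem the equation `𝓔_α(g, ·) = (f, ·)` is then solvable in `𝓕`,
and the energy identity gives uniqueness. Truncations commute with translations and contract
`∂ₓ`, so testing the equation with `(G_α f - k)⁺` yields the maximum principle.

For conservativity, cut off in time at scale `T` and in space at scale `R ≥ T`. Where it varies in
`x`, the cut-off `w` lives on `R ≤ x ≤ 2R`: beyond `β`, where the weight is smooth, and where
`x > 0 ≥ ∂ₓ w` makes the drift term `-b x ∂ₓ w` nonnegative. Hence
`α w - ∂ₜ w - (σ² / 8) ρ⁻¹ ∂ₓ(ρ ∂ₓ w) ≤ α + O(1 / T)`, and comparison gives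
`w ≤ (α + O(1 / T)) G_α 𝟙_E`; letting `T → ∞` forces `α G_α 𝟙_E ≥ 1`.
-/

namespace MovingDomain

noncomputable section

/-! ### Dominated convergence in `Lᵖ` -/

section DominatedConvergence

variable {α ι E : Type*} {mα : MeasurableSpace α} {μ : Measure α} [NormedAddCommGroup E]
  {p : ENNReal} {l : Filter ι} [l.IsCountablyGenerated]

theorem tendsto_eLpNorm_zero_of_dominated (hp : p ≠ ⊤) {f : ι → α → E} {bound : α → ℝ}
    (hbound : MemLp bound p μ) (hf : ∀ᶠ i in l, AEStronglyMeasurable (f i) μ)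
    (hle : ∀ᶠ i in l, ∀ᵐ y ∂μ, ‖f i y‖ ≤ bound y)
    (hlim : ∀ᵐ y ∂μ, Tendsto (fun i => f i y) l (𝓝 0)) :
    Tendsto (fun i => eLpNorm (f i) p μ) l (𝓝 0) := by
  rcases eq_or_ne p 0 with rfl | hp0
  · simp only [eLpNorm_exponent_zero, tendsto_const_nhds]
  have hpos : 0 < p.toReal := ENNReal.toReal_pos hp0 hp
  have hlint : Tendsto (fun i => ∫⁻ y, ‖f i y‖ₑ ^ p.toReal ∂μ) l (𝓝 (∫⁻ _, 0 ∂μ)) := by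
    refine tendsto_lintegral_filter_of_dominated_convergence'
      (fun y => ‖bound y‖ₑ ^ p.toReal) ?_ ?_ ?_ ?_
    · filter_upwards [hf] with i hi using hi.enorm.pow_const _
    · filter_upwards [hle] with i hi
      filter_upwards [hi] with y hy
      gcongr
      exact enorm_le_iff_norm_le.2 (hy.trans (le_abs_self _))
    · exact (lintegral_rpow_enorm_lt_top_of_eLpNorm_lt_top hp0 hp hbound.2).ne
    · filter_upwards [hlim] with y hy
      simpa [hpos, Function.comp_def] using
        ((ENNReal.continuous_rpow_const (y := p.toReal)).tendsto _).comp hy.enorm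
  rw [lintegral_zero] at hlint
  have hroot := (ENNReal.continuous_rpow_const (y := 1 / p.toReal)).tendsto _ |>.comp hlint
  rw [ENNReal.zero_rpow_of_pos (by positivity)] at hroot
  exact hroot.congr fun i => (eLpNorm_eq_lintegral_rpow_enorm_toReal hp0 hp).symm

theorem tendsto_Lp_of_dominated [Fact (1 ≤ p)] (hp : p ≠ ⊤) {F : ι → Lp E p μ} {F₀ : Lp E p μ}
    {f : ι → α → E} {f₀ : α → E} {bound : α → ℝ} (hbound : MemLp bound p μ)
    (hF : ∀ i, F i =ᵐ[μ] f i) (hF₀ : F₀ =ᵐ[μ] f₀)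
    (hle : ∀ᶠ i in l, ∀ᵐ y ∂μ, ‖f i y - f₀ y‖ ≤ bound y)
    (hlim : ∀ᵐ y ∂μ, Tendsto (fun i => f i y) l (𝓝 (f₀ y))) :
    Tendsto F l (𝓝 F₀) := by
  rw [Lp.tendsto_Lp_iff_tendsto_eLpNorm']
  have hsub (i : ι) : ⇑(F i) - ⇑F₀ =ᵐ[μ] f i - f₀ := (hF i).sub hF₀
  refine (tendsto_eLpNorm_zero_of_dominated hp hbound (Eventually.of_forall fun i => ?_) hle
    ?_).congr fun i => (eLpNorm_congr_ae (hsub i)).symm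
  · exact ((Lp.aestronglyMeasurable (F i)).sub (Lp.aestronglyMeasurable F₀)).congr (hsub i)
  · filter_upwards [hlim] with y hy
    simpa using hy.sub_const (f₀ y)

end DominatedConvergence

/-! ### The translation semigroup -/

/-- Translation in time by `max t 0`, i.e. forward by `t ≥ 0`; truncating negative times makes the
orbits of the semigroup functions on all of `ℝ`. -/
def timeShift (t : ℝ) (y : ℝ × ℝ) : ℝ × ℝ := (y.1 + max t 0, y.2)

theorem timeShift_eq_add (t : ℝ) : timeShift t = fun y => y + (max t 0, 0) := by
  ext y <;> simp [timeShift]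

theorem timeShift_of_nonneg {t : ℝ} (ht : 0 ≤ t) (y : ℝ × ℝ) :
    timeShift t y = (y.1 + t, y.2) := by
  rw [timeShift, max_eq_left ht]

theorem continuous_timeShift : Continuous fun z : ℝ × (ℝ × ℝ) => timeShift z.1 z.2 := by
  unfold timeShift; fun_prop

theorem measurable_timeShift (t : ℝ) : Measurable (timeShift t) := by
  unfold timeShift; fun_prop

theorem exists_isCompact_of_timeShift_mem {K : Set (ℝ × ℝ)} (hK : IsCompact K) (T : ℝ) :
    ∃ K' : Set (ℝ × ℝ), IsCompact K' ∧ K ⊆ K' ∧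
      ∀ t ≤ T, ∀ y, timeShift t y ∈ K → y ∈ K' := by
  refine ⟨(fun z : ℝ × (ℝ × ℝ) => z.2 - (z.1, 0)) '' (Icc 0 (max T 0) ×ˢ K),
    (isCompact_Icc.prod hK).image (by fun_prop), fun y hy => ?_, fun t ht y hy => ?_⟩
  · exact ⟨(0, y), ⟨⟨le_rfl, le_max_right _ _⟩, hy⟩, by simp⟩
  · refine ⟨(max t 0, timeShift t y), ⟨⟨le_max_right _ _, max_le_max_right 0 ht⟩, hy⟩, ?_⟩
    ext <;> simp [timeShift]

/-- Measures that do not increase under forward time translation. They are the ones for which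
`U_t F (s, x) = F (s + t, x)`, `t ≥ 0`, is a contraction on every `Lᵖ(μ)`. -/
class IsTranslationSubinvariant (μ : Measure (ℝ × ℝ)) : Prop where
  map_timeShift_le : ∀ t, μ.map (timeShift t) ≤ μ

section Translation

variable {μ : Measure (ℝ × ℝ)} [IsTranslationSubinvariant μ] {p : ENNReal}
  {E : Type*} [NormedAddCommGroup E]

theorem quasiMeasurePreserving_timeShift (t : ℝ) :
    Measure.QuasiMeasurePreserving (timeShift t) μ μ :=
  ⟨measurable_timeShift t, (IsTranslationSubinvariant.map_timeShift_le t).absolutelyContinuous⟩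

theorem ae_timeShift (t : ℝ) {P : ℝ × ℝ → Prop} (h : ∀ᵐ y ∂μ, P y) :
    ∀ᵐ y ∂μ, P (timeShift t y) :=
  (quasiMeasurePreserving_timeShift t).ae h

theorem eLpNorm_comp_timeShift_le (t : ℝ) (p : ENNReal) {F : ℝ × ℝ → E}
    (hF : AEStronglyMeasurable F μ) : eLpNorm (F ∘ timeShift t) p μ ≤ eLpNorm F p μ := by
  have hle : μ.map (timeShift t) ≤ μ := IsTranslationSubinvariant.map_timeShift_le t
  rw [← eLpNorm_map_measure (hF.mono_measure hle) (measurable_timeShift t).aemeasurable]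
  exact eLpNorm_mono_measure _ hle

theorem memLp_comp_timeShift (t : ℝ) {F : ℝ × ℝ → E} (hF : MemLp F p μ) :
    MemLp (F ∘ timeShift t) p μ :=
  ⟨hF.1.comp_quasiMeasurePreserving (quasiMeasurePreserving_timeShift t),
    (eLpNorm_comp_timeShift_le t p hF.1).trans_lt hF.2⟩

theorem integrable_comp_timeShift (t : ℝ) {F : ℝ × ℝ → E} (hF : Integrable F μ) :
    Integrable (fun y => F (timeShift t y)) μ :=
  memLp_one_iff_integrable.1 (memLp_comp_timeShift t (memLp_one_iff_integrable.2 hF))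

theorem integral_comp_timeShift_le (t : ℝ) {F : ℝ × ℝ → ℝ} (hF : Integrable F μ)
    (hF0 : ∀ y, 0 ≤ F y) : ∫ y, F (timeShift t y) ∂μ ≤ ∫ y, F y ∂μ := by
  have hle : μ.map (timeShift t) ≤ μ := IsTranslationSubinvariant.map_timeShift_le t
  rw [← integral_map (measurable_timeShift t).aemeasurable (hF.1.mono_measure hle)]
  exact integral_mono_measure hle (ae_of_all _ hF0) hF

theorem norm_toLp_comp_timeShift_le (t : ℝ) (F : Lp E p μ) :
    ‖(memLp_comp_timeShift t (Lp.memLp F)).toLp _‖ ≤ ‖F‖ := by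
  rw [Lp.norm_toLp, Lp.norm_def]
  exact ENNReal.toReal_mono (Lp.memLp F).2.ne
    (eLpNorm_comp_timeShift_le t p (Lp.aestronglyMeasurable F))

variable [Fact (1 ≤ p)] [NormedSpace ℝ E]

/-- The translation `U_t` on `Lᵖ(μ)`, the identity for `t < 0`. -/
def translate (t : ℝ) : Lp E p μ →L[ℝ] Lp E p μ :=
  LinearMap.mkContinuous
    { toFun := fun F => (memLp_comp_timeShift t (Lp.memLp F)).toLp _
      map_add' := fun F G => by
        rw [← MemLp.toLp_add]
        exact MemLp.toLp_congr _ _ (ae_timeShift t (Lp.coeFn_add F G))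
      map_smul' := fun r F => by
        rw [RingHom.id_apply, ← MemLp.toLp_const_smul]
        exact MemLp.toLp_congr _ _ (ae_timeShift t (Lp.coeFn_smul r F)) }
    1 fun F => (norm_toLp_comp_timeShift_le t F).trans_eq (one_mul _).symm

theorem coeFn_translate (t : ℝ) (F : Lp E p μ) :
    translate t F =ᵐ[μ] fun y => F (timeShift t y) :=
  MemLp.coeFn_toLp (memLp_comp_timeShift t (Lp.memLp F))

theorem translate_ae_eq {t : ℝ} {F : Lp E p μ} {f : ℝ × ℝ → E} (hF : F =ᵐ[μ] f) :
    translate t F =ᵐ[μ] fun y => f (timeShift t y) :=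
  (coeFn_translate t F).trans (ae_timeShift t hF)

theorem norm_translate_le (t : ℝ) (F : Lp E p μ) : ‖translate t F‖ ≤ ‖F‖ := by
  change ‖(memLp_comp_timeShift t (Lp.memLp F)).toLp _‖ ≤ ‖F‖
  exact norm_toLp_comp_timeShift_le t F

theorem translate_translate {s t : ℝ} (hs : 0 ≤ s) (ht : 0 ≤ t) (F : Lp E p μ) :
    translate s (translate t F) = translate (t + s) F := by
  ext1
  filter_upwards [translate_ae_eq (t := s) (coeFn_translate t F), coeFn_translate (t + s) F]
    with y hst hts
  rw [hst, hts, timeShift_of_nonneg hs, timeShift_of_nonneg ht,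
    timeShift_of_nonneg (add_nonneg ht hs), add_right_comm, ← add_assoc]

theorem translate_zero (F : Lp E p μ) : translate 0 F = F := by
  ext1
  filter_upwards [coeFn_translate 0 F] with y hy
  rw [hy, timeShift_of_nonneg le_rfl, add_zero]

theorem translate_sub_ae_eq {t : ℝ} {F : Lp E p μ} {f : ℝ × ℝ → E} (hF : F =ᵐ[μ] f) :
    ⇑(t⁻¹ • (translate t F - F)) =ᵐ[μ] fun y => t⁻¹ • (f (timeShift t y) - f y) := by
  filter_upwards [translate_ae_eq (t := t) hF, hF, Lp.coeFn_smul t⁻¹ (translate t F - F),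
    Lp.coeFn_sub (translate t F) F] with y hshift hy hsmul hsub
  rw [hsmul, Pi.smul_apply, hsub, Pi.sub_apply, hshift, hy]

theorem continuous_translate_of_continuous [IsFiniteMeasureOnCompacts μ] (hp : p ≠ ⊤)
    {F : Lp E p μ} {g : ℝ × ℝ → E} (hg : Continuous g) (hsupp : HasCompactSupport g)
    (hF : F =ᵐ[μ] g) : Continuous fun t => translate t F := by
  rw [continuous_iff_continuousAt]
  intro t₀
  obtain ⟨M, hM⟩ := hg.bounded_above_of_compact_support hsupp
  obtain ⟨K, hK, -, hmem⟩ := exists_isCompact_of_timeShift_mem hsupp (t₀ + 1)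
  have hzero : ∀ t ≤ t₀ + 1, ∀ y ∉ K, g (timeShift t y) = 0 := fun t ht y hy =>
    image_eq_zero_of_notMem_tsupport fun h => hy (hmem t ht y h)
  refine tendsto_Lp_of_dominated hp (bound := K.indicator fun _ => M + M)
    (memLp_indicator_const p hK.measurableSet _ (Or.inr hK.measure_lt_top.ne))
    (fun t => translate_ae_eq hF) (translate_ae_eq hF) ?_ ?_
  · filter_upwards [Iic_mem_nhds (lt_add_one t₀)] with t ht
    refine ae_of_all _ fun y => ?_
    by_cases hy : y ∈ K
    · rw [indicator_of_mem hy]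
      exact norm_sub_le_of_le (hM _) (hM _)
    · rw [indicator_of_notMem hy, hzero t ht y hy, hzero t₀ (by linarith) y hy, sub_self, norm_zero]
  · exact ae_of_all _ fun y =>
      (hg.comp (continuous_timeShift.comp (by fun_prop : Continuous fun t : ℝ => (t, y)))).tendsto _

theorem inner_translate_sub_nonpos (t : ℝ) (F : Lp ℝ 2 μ) :
    inner ℝ (translate t F - F) F ≤ 0 := by
  rw [inner_sub_left, real_inner_self_eq_norm_mul_norm, sub_nonpos]
  exact (real_inner_le_norm _ _).trans
    (mul_le_mul_of_nonneg_right (norm_translate_le t F) (norm_nonneg F))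

end Translation

theorem tendsto_inv_smul_integral {X : Type*} [NormedAddCommGroup X] [NormedSpace ℝ X]
    [CompleteSpace X] {f : ℝ → X} (hf : Continuous f) (a : ℝ) :
    Tendsto (fun t : ℝ => t⁻¹ • ∫ s in a..(a + t), f s) (𝓝[>] 0) (𝓝 (f a)) := by
  have hderiv := intervalIntegral.integral_hasDerivAt_right (hf.intervalIntegrable a a)
    (hf.stronglyMeasurableAtFilter _ _) hf.continuousAt
  simpa using (hasDerivAt_iff_tendsto_slope_zero.1 hderiv).mono_left (nhdsGT_le_nhdsNE 0)

/-! ### A Lions type existence theorem -/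

section Lions

variable {X : Type*} [NormedAddCommGroup X] [InnerProductSpace ℝ X] [CompleteSpace X]

theorem eq_top_of_forall_apply_eq_zero {R : Submodule ℝ (StrongDual ℝ X)}
    (hclosed : IsClosed (R : Set (StrongDual ℝ X)))
    (hR : ∀ v : X, (∀ ℓ ∈ R, ℓ v = 0) → v = 0) : R = ⊤ := by
  let e := InnerProductSpace.toDual ℝ X
  let S : Submodule ℝ X := R.comap e.toLinearEquiv.toLinearMap
  have hS : IsClosed (S : Set X) := hclosed.preimage e.continuous
  have : CompleteSpace S := hS.completeSpace_coe
  have hbot : Sᗮ = ⊥ := by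
    refine (Submodule.eq_bot_iff _).2 fun v hv => hR v fun ℓ hℓ => ?_
    have hmem : e.symm ℓ ∈ S := by
      change e (e.symm ℓ) ∈ R
      rwa [e.apply_symm_apply]
    rw [← InnerProductSpace.toDual_symm_apply]
    exact (Submodule.mem_orthogonal S v).1 hv _ hmem
  refine (Submodule.eq_top_iff').2 fun ℓ => ?_
  have hmem : e.symm ℓ ∈ S := by
    rw [(Submodule.orthogonal_eq_bot_iff).1 hbot]
    exact Submodule.mem_top
  simpa only [e.apply_symm_apply] using (show e (e.symm ℓ) ∈ R from hmem)

theorem surjective_of_antilipschitzWith {Y : Type*} [NormedAddCommGroup Y] [NormedSpace ℝ Y]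
    [CompleteSpace Y] {T : Y →L[ℝ] StrongDual ℝ X} {K : NNReal} (hT : AntilipschitzWith K T)
    (htriv : ∀ v : X, (∀ y, T y v = 0) → v = 0) : Function.Surjective T := by
  have hclosed : IsClosed (T.range : Set (StrongDual ℝ X)) :=
    hT.isClosed_range T.uniformContinuous
  exact LinearMap.range_eq_top.1 <| eq_top_of_forall_apply_eq_zero hclosed fun v hv =>
    htriv v fun y => hv _ ⟨y, rfl⟩

variable {B : X →L[ℝ] X →L[ℝ] ℝ} {G : Submodule ℝ (X × StrongDual ℝ X)}

omit [CompleteSpace X] in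
theorem apply_nonpos_of_mem_topologicalClosure (hG : ∀ q ∈ G, q.2 q.1 ≤ 0)
    {q : X × StrongDual ℝ X} (hq : q ∈ G.topologicalClosure) : q.2 q.1 ≤ 0 :=
  closure_minimal hG
    (isClosed_le (continuous_snd.clm_apply continuous_fst) continuous_const) hq

omit [CompleteSpace X] in
theorem norm_fst_le_of_isCoercive {C : ℝ} (hC : 0 < C) (hB : ∀ u, C * ‖u‖ * ‖u‖ ≤ B u u)
    {q : X × StrongDual ℝ X} (hq : q.2 q.1 ≤ 0) : ‖q.1‖ ≤ C⁻¹ * ‖B q.1 - q.2‖ := by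
  rw [le_inv_mul_iff₀ hC]
  rcases (norm_nonneg q.1).eq_or_lt with h0 | h0
  · rw [← h0, mul_zero]; exact norm_nonneg _
  · refine le_of_mul_le_mul_right ?_ h0
    calc C * ‖q.1‖ * ‖q.1‖ ≤ B q.1 q.1 - q.2 q.1 := by linarith [hB q.1]
      _ ≤ ‖B q.1 - q.2‖ * ‖q.1‖ := (le_abs_self _).trans ((B q.1 - q.2).le_opNorm q.1)

omit [CompleteSpace X] in
theorem norm_le_of_isCoercive {C : ℝ} (hC : 0 < C) (hB : ∀ u, C * ‖u‖ * ‖u‖ ≤ B u u)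
    {q : X × StrongDual ℝ X} (hq : q.2 q.1 ≤ 0) :
    ‖q‖ ≤ (C⁻¹ + (‖B‖ * C⁻¹ + 1)) * ‖B q.1 - q.2‖ := by
  have hfst := norm_fst_le_of_isCoercive hC hB hq
  have hsnd : ‖q.2‖ ≤ (‖B‖ * C⁻¹ + 1) * ‖B q.1 - q.2‖ :=
    calc ‖q.2‖ = ‖B q.1 - (B q.1 - q.2)‖ := by rw [sub_sub_cancel]
      _ ≤ ‖B‖ * ‖q.1‖ + ‖B q.1 - q.2‖ := norm_sub_le_of_le (B.le_opNorm _) le_rfl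
      _ ≤ ‖B‖ * (C⁻¹ * ‖B q.1 - q.2‖) + ‖B q.1 - q.2‖ := by gcongr
      _ = _ := by ring
  calc ‖q‖ ≤ ‖q.1‖ + ‖q.2‖ := max_le_add_of_nonneg (norm_nonneg _) (norm_nonneg _)
    _ ≤ _ := by rw [add_mul]; exact add_le_add hfst hsnd

theorem exists_mem_closure_sub_eq_of_isCoercive (hB : IsCoercive B) (hG : ∀ q ∈ G, q.2 q.1 ≤ 0)
    (hdense : ∀ v, (∀ q ∈ G, B q.1 v = q.2 v) → v = 0) (ℓ : StrongDual ℝ X) :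
    ∃ q ∈ G.topologicalClosure, B q.1 - q.2 = ℓ := by
  obtain ⟨C, hC, hBC⟩ := hB
  let L : X × StrongDual ℝ X →L[ℝ] StrongDual ℝ X :=
    B.comp (ContinuousLinearMap.fst ℝ _ _) - ContinuousLinearMap.snd ℝ _ _
  let T : G.topologicalClosure →L[ℝ] StrongDual ℝ X := L.comp G.topologicalClosure.subtypeL
  have : CompleteSpace G.topologicalClosure := G.isClosed_topologicalClosure.completeSpace_coe
  have hanti : AntilipschitzWith (Real.toNNReal (C⁻¹ + (‖B‖ * C⁻¹ + 1))) T :=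
    T.antilipschitz_of_bound fun (q : G.topologicalClosure) => by
      rw [Real.coe_toNNReal _ (by positivity)]
      exact norm_le_of_isCoercive hC hBC (apply_nonpos_of_mem_topologicalClosure hG q.2)
  have hsurj : Function.Surjective T := surjective_of_antilipschitzWith
    (Y := G.topologicalClosure) hanti fun v hv =>
    hdense v fun q hq => sub_eq_zero.1 (hv ⟨q, G.le_topologicalClosure hq⟩)
  obtain ⟨q, hq⟩ := hsurj ℓ
  exact ⟨q, q.2, hq⟩

end Lions

/-! ### Normal contractions -/

section NormalContraction

variable (g : C(ℝ, unitInterval))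

/-- The normal contraction `φ` with derivative `φ' = g` and `φ(0) = 0`. Taking `g` continuous makes
`φ` a `C¹` function, so that composition with it preserves `C_0^1`. -/
def normalContraction (r : ℝ) : ℝ := ∫ s in (0 : ℝ)..r, (g s : ℝ)

/-- The convex primitive of a normal contraction. -/
def contractionPotential (r : ℝ) : ℝ := ∫ s in (0 : ℝ)..r, normalContraction g s

theorem continuous_coe_unitInterval : Continuous fun s => (g s : ℝ) := by fun_prop

theorem normalContraction_zero : normalContraction g 0 = 0 := intervalIntegral.integral_same

theorem hasDerivAt_normalContraction (r : ℝ) : HasDerivAt (normalContraction g) (g r) r :=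
  ((continuous_coe_unitInterval g).integral_hasStrictDerivAt 0 r).hasDerivAt

theorem contDiff_normalContraction : ContDiff ℝ 1 (normalContraction g) := by
  rw [contDiff_one_iff_deriv, funext fun r => (hasDerivAt_normalContraction g r).deriv]
  exact ⟨fun r => (hasDerivAt_normalContraction g r).differentiableAt,
    continuous_coe_unitInterval g⟩

theorem lipschitzWith_normalContraction : LipschitzWith 1 (normalContraction g) := by
  refine lipschitzWith_of_nnnorm_deriv_le
    (fun r => (hasDerivAt_normalContraction g r).differentiableAt) fun r => ?_
  rw [(hasDerivAt_normalContraction g r).deriv, ← NNReal.coe_le_coe, coe_nnnorm,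
    Real.norm_of_nonneg (g r).2.1]
  exact (g r).2.2

theorem monotone_normalContraction : Monotone (normalContraction g) :=
  monotone_of_deriv_nonneg (fun r => (hasDerivAt_normalContraction g r).differentiableAt)
    fun r => (hasDerivAt_normalContraction g r).deriv.symm ▸ (g r).2.1

theorem abs_normalContraction_le (r : ℝ) : |normalContraction g r| ≤ |r| := by
  simpa [Real.dist_eq, normalContraction_zero] using
    (lipschitzWith_normalContraction g).dist_le_mul r 0

theorem continuous_contractionPotential : Continuous (contractionPotential g) :=
  continuous_iff_continuousAt.2 fun r =>
    ((lipschitzWith_normalContraction g).continuous.integral_hasStrictDerivAt 0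
      r).hasDerivAt.continuousAt

theorem normalContraction_mul_sub_le (a b : ℝ) :
    normalContraction g a * (b - a) ≤ contractionPotential g b - contractionPotential g a := by
  have hint (a b : ℝ) : IntervalIntegrable (normalContraction g) volume a b :=
    (lipschitzWith_normalContraction g).continuous.intervalIntegrable a b
  rw [contractionPotential, contractionPotential,
    intervalIntegral.integral_interval_sub_left (hint _ _) (hint _ _), mul_comm]
  rcases le_total a b with hab | hba
  · simpa using intervalIntegral.integral_mono_on (f := fun _ => normalContraction g a) hab
      (by simp) (hint a b) fun s hs => monotone_normalContraction g hs.1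
  · have hle := intervalIntegral.integral_mono_on (g := fun _ => normalContraction g a) hba
      (hint b a) (by simp) fun s hs => monotone_normalContraction g hs.2
    rw [intervalIntegral.integral_const, smul_eq_mul] at hle
    rw [intervalIntegral.integral_symm]
    linarith

theorem contractionPotential_zero : contractionPotential g 0 = 0 := intervalIntegral.integral_same

theorem contractionPotential_nonneg (r : ℝ) : 0 ≤ contractionPotential g r := by
  simpa [normalContraction_zero, contractionPotential_zero] using
    normalContraction_mul_sub_le g 0 r

theorem contractionPotential_le (r : ℝ) : contractionPotential g r ≤ r * r := by
  have htangent := normalContraction_mul_sub_le g r 0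
  rw [contractionPotential_zero, zero_sub, zero_sub, mul_neg, neg_le_neg_iff] at htangent
  calc contractionPotential g r ≤ |normalContraction g r| * |r| :=
        htangent.trans ((le_abs_self _).trans_eq (abs_mul _ _))
    _ ≤ |r| * |r| := mul_le_mul_of_nonneg_right (abs_normalContraction_le g r) (abs_nonneg r)
    _ = r * r := abs_mul_abs_self r

/-- The derivative `min(1, (r - k)⁺)` of a `C¹` substitute for the contraction `r ↦ (r - k)⁺`. -/
def ramp (k : ℝ) : C(ℝ, unitInterval) where
  toFun r := projIcc 0 1 zero_le_one (r - k)
  continuous_toFun := by fun_prop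

theorem ramp_of_le {k r : ℝ} (h : r ≤ k) : (ramp k r : ℝ) = 0 := by
  simp only [ramp, ContinuousMap.coe_mk, projIcc_of_le_left zero_le_one (sub_nonpos.2 h)]

theorem ramp_pos {k r : ℝ} (h : k < r) : 0 < (ramp k r : ℝ) := by
  simp only [ramp, ContinuousMap.coe_mk, coe_projIcc]
  exact lt_max_of_lt_right (lt_min one_pos (sub_pos.2 h))

theorem normalContraction_ramp_of_le {k r : ℝ} (hk : 0 ≤ k) (h : r ≤ k) :
    normalContraction (ramp k) r = 0 :=
  intervalIntegral.integral_zero_ae <| ae_of_all _ fun _ hs =>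
    ramp_of_le (hs.2.trans (max_le hk h))

theorem normalContraction_ramp_pos {k r : ℝ} (hk : 0 ≤ k) (h : k < r) :
    0 < normalContraction (ramp k) r := by
  have hint (a b : ℝ) : IntervalIntegrable (fun s => (ramp k s : ℝ)) volume a b :=
    (continuous_coe_unitInterval _).intervalIntegrable a b
  have hzero := normalContraction_ramp_of_le hk le_rfl
  rw [normalContraction] at hzero ⊢
  rw [← intervalIntegral.integral_add_adjacent_intervals (hint 0 k) (hint k r), hzero, zero_add]
  exact intervalIntegral.intervalIntegral_pos_of_pos_on (hint _ _) (fun s hs => ramp_pos hs.1) h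

variable {Ω : Type*} {mΩ : MeasurableSpace Ω} {μ : Measure Ω}

theorem inner_eq_integral (F G : Lp ℝ 2 μ) : inner ℝ F G = ∫ y, F y * G y ∂μ := by
  simp only [L2.inner_def, RCLike.inner_apply, conj_trivial, mul_comm]

theorem integrable_mul (F G : Lp ℝ 2 μ) : Integrable (fun y => F y * G y) μ :=
  (Lp.memLp F).integrable_mul (Lp.memLp G)

/-- `F ↦ φ ∘ F` on `L²`, where `φ` is the normal contraction with derivative `g`. -/
def compContraction (F : Lp ℝ 2 μ) : Lp ℝ 2 μ :=
  (lipschitzWith_normalContraction g).compLp (normalContraction_zero g) F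

theorem coeFn_compContraction (F : Lp ℝ 2 μ) :
    compContraction g F =ᵐ[μ] fun y => normalContraction g (F y) :=
  (lipschitzWith_normalContraction g).coeFn_compLp (normalContraction_zero g) F

theorem continuous_compContraction : Continuous (compContraction g : Lp ℝ 2 μ → Lp ℝ 2 μ) :=
  (lipschitzWith_normalContraction g).continuous_compLp (normalContraction_zero g)

theorem norm_coe_mul_le (a b : ℝ) : ‖(g a : ℝ) * b‖ ≤ ‖b‖ := by
  rw [norm_mul, Real.norm_of_nonneg (g a).2.1]
  exact mul_le_of_le_one_left (norm_nonneg _) (g a).2.2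

theorem memLp_coe_mul (F K : Lp ℝ 2 μ) : MemLp (fun y => (g (F y) : ℝ) * K y) 2 μ :=
  (Lp.memLp K).of_le (((continuous_coe_unitInterval g).comp_aestronglyMeasurable
    (Lp.aestronglyMeasurable F)).mul (Lp.aestronglyMeasurable K))
    (ae_of_all _ fun _ => norm_coe_mul_le g _ _)

/-- The product `g(F) K` in `L²`; for `K = ∂ₓF` it is the derivative of `φ ∘ F`. -/
def mulComp (F K : Lp ℝ 2 μ) : Lp ℝ 2 μ := (memLp_coe_mul g F K).toLp _

theorem coeFn_mulComp (F K : Lp ℝ 2 μ) :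
    mulComp g F K =ᵐ[μ] fun y => (g (F y) : ℝ) * K y :=
  MemLp.coeFn_toLp (memLp_coe_mul g F K)

theorem mulComp_add (F K L : Lp ℝ 2 μ) : mulComp g F (K + L) = mulComp g F K + mulComp g F L := by
  ext1
  filter_upwards [coeFn_mulComp g F (K + L), coeFn_mulComp g F K, coeFn_mulComp g F L,
    Lp.coeFn_add K L, Lp.coeFn_add (mulComp g F K) (mulComp g F L)] with y hKL hK hL hadd hadd'
  rw [hKL, hadd', Pi.add_apply, hK, hL, hadd, Pi.add_apply, mul_add]

theorem norm_mulComp_le (F K : Lp ℝ 2 μ) : ‖mulComp g F K‖ ≤ ‖K‖ := by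
  refine Lp.norm_le_norm_of_ae_le ?_
  filter_upwards [coeFn_mulComp g F K] with y hy
  exact hy ▸ norm_coe_mul_le g _ _

theorem tendsto_mulComp_left {F : ℕ → Lp ℝ 2 μ} {F₀ : Lp ℝ 2 μ} (hF : Tendsto F atTop (𝓝 F₀))
    (K : Lp ℝ 2 μ) : Tendsto (fun n => mulComp g (F n) K) atTop (𝓝 (mulComp g F₀ K)) := by
  refine tendsto_of_subseq_tendsto fun ns hns => ?_
  obtain ⟨ms, -, hms⟩ := (tendstoInMeasure_of_tendsto_Lp (hF.comp hns)).exists_seq_tendsto_ae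
  refine ⟨ms, tendsto_Lp_of_dominated ENNReal.ofNat_ne_top (bound := fun y => ‖K y‖)
    (Lp.memLp K).norm (fun n => coeFn_mulComp g (F (ns (ms n))) K) (coeFn_mulComp g F₀ K) ?_ ?_⟩
  · refine Eventually.of_forall fun n => ae_of_all _ fun y => ?_
    rw [← sub_mul, norm_mul]
    refine mul_le_of_le_one_left (norm_nonneg _) (abs_sub_le_iff.2 ⟨?_, ?_⟩)
    · linarith [(g (F (ns (ms n)) y)).2.2, (g (F₀ y)).2.1]
    · linarith [(g (F (ns (ms n)) y)).2.1, (g (F₀ y)).2.2]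
  · filter_upwards [hms] with y hy
    exact (((continuous_coe_unitInterval g).tendsto _).comp hy).mul_const _

theorem continuous_mulComp :
    Continuous fun q : Lp ℝ 2 μ × Lp ℝ 2 μ => mulComp g q.1 q.2 := by
  rw [continuous_iff_seqContinuous]
  intro x q hx
  have hfst : Tendsto (fun n => (x n).1) atTop (𝓝 q.1) := (continuous_fst.tendsto q).comp hx
  have hsnd : Tendsto (fun n => (x n).2) atTop (𝓝 q.2) := (continuous_snd.tendsto q).comp hx
  have hdiff : Tendsto (fun n => mulComp g (x n).1 ((x n).2 - q.2)) atTop (𝓝 0) :=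
    squeeze_zero_norm (fun n => norm_mulComp_le g _ _)
      (tendsto_iff_norm_sub_tendsto_zero.1 hsnd)
  have hsum := hdiff.add (tendsto_mulComp_left g hfst q.2)
  simp only [← mulComp_add, sub_add_cancel, zero_add] at hsum
  exact hsum

theorem inner_mulComp_nonneg (F K : Lp ℝ 2 μ) : 0 ≤ inner ℝ K (mulComp g F K) := by
  rw [inner_eq_integral]
  refine integral_nonneg_of_ae ?_
  filter_upwards [coeFn_mulComp g F K] with y hy
  rw [hy, Pi.zero_apply, mul_left_comm]
  exact mul_nonneg (g (F y)).2.1 (mul_self_nonneg _)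

theorem integrable_contractionPotential (F : Lp ℝ 2 μ) :
    Integrable (fun y => contractionPotential g (F y)) μ := by
  refine (integrable_mul F F).mono' ((continuous_contractionPotential g).comp_aestronglyMeasurable
    (Lp.aestronglyMeasurable F)) (ae_of_all _ fun y => ?_)
  rw [Real.norm_of_nonneg (contractionPotential_nonneg g _)]
  exact contractionPotential_le g _

theorem inner_translate_sub_compContraction_nonpos {μ : Measure (ℝ × ℝ)}
    [IsTranslationSubinvariant μ] (t : ℝ) (F : Lp ℝ 2 μ) :
    inner ℝ (translate t F - F) (compContraction g F) ≤ 0 := by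
  have hΦ := integrable_contractionPotential g F
  have hΦt := integrable_comp_timeShift t hΦ
  rw [inner_eq_integral]
  calc ∫ y, (translate t F - F : Lp ℝ 2 μ) y * compContraction g F y ∂μ
      ≤ ∫ y, (contractionPotential g (F (timeShift t y)) - contractionPotential g (F y)) ∂μ := by
        refine integral_mono_ae (integrable_mul _ _) (hΦt.sub hΦ) ?_
        filter_upwards [coeFn_translate t F, Lp.coeFn_sub (translate t F) F,
          coeFn_compContraction g F] with y hshift hsub hcomp
        rw [hsub, hcomp, Pi.sub_apply, hshift, mul_comm]
        exact normalContraction_mul_sub_le g (F y) (F (timeShift t y))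
    _ ≤ 0 := by
        rw [integral_sub hΦt hΦ, sub_nonpos]
        exact integral_comp_timeShift_le t hΦ fun y => contractionPotential_nonneg g _

theorem ae_le_of_inner_compContraction_ramp_nonpos {α k : ℝ} (hα : 0 < α) (hk : 0 ≤ k)
    {f F : Lp ℝ 2 μ} (hf : ∀ᵐ y ∂μ, f y ≤ α * k)
    (hinner : inner ℝ (α • F - f) (compContraction (ramp k) F) ≤ 0) : ∀ᵐ y ∂μ, F y ≤ k := by
  rw [inner_eq_integral] at hinner
  have hprod : ∀ᵐ y ∂μ, (α • F - f : Lp ℝ 2 μ) y * compContraction (ramp k) F y =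
      (α * F y - f y) * normalContraction (ramp k) (F y) := by
    filter_upwards [Lp.coeFn_sub (α • F) f, Lp.coeFn_smul α F, coeFn_compContraction (ramp k) F]
      with y hsub hsmul hcomp
    rw [hsub, hcomp, Pi.sub_apply, hsmul, Pi.smul_apply, smul_eq_mul]
  have hpos : ∀ y, f y ≤ α * k → k < F y →
      0 < (α * F y - f y) * normalContraction (ramp k) (F y) := fun y hy hF =>
    mul_pos (by nlinarith) (normalContraction_ramp_pos hk hF)
  have hnonneg : 0 ≤ᵐ[μ] fun y => (α • F - f : Lp ℝ 2 μ) y * compContraction (ramp k) F y := by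
    filter_upwards [hprod, hf] with y hy hfy
    rw [hy, Pi.zero_apply]
    rcases le_or_gt (F y) k with hF | hF
    · rw [normalContraction_ramp_of_le hk hF, mul_zero]
    · exact (hpos y hfy hF).le
  have hzero := (integral_eq_zero_iff_of_nonneg_ae hnonneg (integrable_mul _ _)).1
    (le_antisymm hinner (integral_nonneg_of_ae hnonneg))
  filter_upwards [hprod, hf, hzero] with y hy hfy h0
  by_contra! hF
  exact (hpos y hfy hF).ne' (hy.symm.trans h0)

end NormalContraction

/-! ### The reference measure -/

/-- The conditions on the data under which the reference measure is locally finite and increasing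
in time. -/
class Admissible (c : Data) : Prop where
  one_le_delta : 1 ≤ c.delta
  p_nonneg : 0 ≤ c.p
  p_le_one : c.p ≤ 1
  integrableOn_dlam : ∀ t, IntegrableOn c.dlam (Icc 0 t)
  rhoMonotone : RhoMonotone c

/-- The density of the reference measure with respect to Lebesgue measure on `ℝ²`. -/
def dens (c : Data) : ℝ × ℝ → ENNReal := (dom c).indicator fun y => ENNReal.ofReal (rho c y.1 y.2)

theorem continuous_integral_max {f : ℝ → ℝ} (hf : ∀ t, IntegrableOn f (Icc 0 t)) :
    Continuous fun t => ∫ s in (0 : ℝ)..max t 0, f s := by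
  refine continuous_iff_continuousAt.2 fun t => ?_
  have hIic : Iic (t + 1) ∈ 𝓝 t := Iic_mem_nhds (lt_add_one t)
  have hle : (0 : ℝ) ≤ max (t + 1) 0 := le_max_right _ _
  have hprim := intervalIntegral.continuousOn_primitive_interval (f := f) (μ := volume)
    (a := 0) (b := max (t + 1) 0) (by rw [uIcc_of_le hle]; exact hf _)
  rw [uIcc_of_le hle] at hprim
  have hmax : ContinuousOn (fun s : ℝ => max s 0) (Iic (t + 1)) := by fun_prop
  have hmaps : MapsTo (fun s : ℝ => max s 0) (Iic (t + 1)) (Icc 0 (max (t + 1) 0)) :=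
    fun s hs => ⟨le_max_right _ _, max_le_max_right 0 hs⟩
  exact (hprim.comp hmax hmaps).continuousAt hIic

section Density

variable {c : Data}

theorem gamma_nonneg {t : ℝ} (ht : 0 ≤ t) : 0 ≤ gamma c t :=
  intervalIntegral.integral_nonneg ht fun _ _ => le_max_right _ _

theorem beta_le_lam_zero {t : ℝ} (ht : 0 ≤ t) : beta c t ≤ c.lam 0 :=
  add_le_of_nonpos_left <| neg_nonpos.2 <|
    intervalIntegral.integral_nonneg ht fun _ _ => le_max_right _ _

theorem rho_of_beta_le {t x : ℝ} (h : beta c t ≤ x) : rho c t x =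
    c.p * |x + gamma c t| ^ (c.delta - 1) * Real.exp (-(c.b * x ^ 2 / 2)) := by
  rw [rho, indicator_of_notMem (fun hx => hx.2.not_ge h), indicator_of_mem (mem_Ici.2 h),
    mul_zero, zero_add, mul_one]

theorem dens_of_mem {y : ℝ × ℝ} (hy : y ∈ dom c) : dens c y = ENNReal.ofReal (rho c y.1 y.2) :=
  indicator_of_mem hy _

theorem dens_of_notMem {y : ℝ × ℝ} (hy : y ∉ dom c) : dens c y = 0 := indicator_of_notMem hy _

theorem dens_lt_top (y : ℝ × ℝ) : dens c y < ⊤ := by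
  by_cases hy : y ∈ dom c
  · exact dens_of_mem hy ▸ ENNReal.ofReal_lt_top
  · exact dens_of_notMem hy ▸ ENNReal.zero_lt_top

variable [Admissible c]

theorem integrableOn_dlam_pos (t : ℝ) : IntegrableOn (fun s => max (c.dlam s) 0) (Icc 0 t) :=
  (Admissible.integrableOn_dlam t).pos_part

theorem integrableOn_dlam_neg (t : ℝ) : IntegrableOn (fun s => max (-(c.dlam s)) 0) (Icc 0 t) :=
  (Admissible.integrableOn_dlam t).neg_part

variable (c) in
theorem continuous_gamma_max : Continuous fun t => gamma c (max t 0) :=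
  continuous_integral_max integrableOn_dlam_pos

variable (c) in
theorem continuous_beta_max : Continuous fun t => beta c (max t 0) :=
  (continuous_integral_max integrableOn_dlam_neg).neg.add continuous_const

theorem gamma_mono {s t : ℝ} (hs : 0 ≤ s) (hst : s ≤ t) : gamma c s ≤ gamma c t :=
  intervalIntegral.integral_mono_interval le_rfl hs hst (ae_of_all _ fun _ => le_max_right _ _)
    ((intervalIntegrable_iff_integrableOn_Icc_of_le (hs.trans hst)).2 (integrableOn_dlam_pos t))

theorem mem_dom_of_le {s t x : ℝ} (h : (s, x) ∈ dom c) (hst : s ≤ t) : (t, x) ∈ dom c :=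
  ⟨h.1.trans hst, (neg_le_neg (gamma_mono h.1 hst)).trans h.2⟩

theorem rho_nonneg (t x : ℝ) : 0 ≤ rho c t x := by
  have hind (s : Set ℝ) : 0 ≤ s.indicator (fun _ => (1 : ℝ)) x :=
    indicator_nonneg (fun _ _ => zero_le_one) _
  have hp := sub_nonneg.2 (Admissible.p_le_one (c := c))
  exact mul_nonneg (mul_nonneg (add_nonneg (mul_nonneg hp (hind _))
    (mul_nonneg Admissible.p_nonneg (hind _))) (by positivity)) (Real.exp_nonneg _)

theorem rho_le (t x : ℝ) :
    rho c t x ≤ |x + gamma c t| ^ (c.delta - 1) * Real.exp (-(c.b * x ^ 2 / 2)) := by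
  have hp₀ : 0 ≤ c.p := Admissible.p_nonneg
  have hp₁ : c.p ≤ 1 := Admissible.p_le_one
  rw [rho, mul_assoc]
  refine mul_le_of_le_one_left (by positivity) ?_
  by_cases h : beta c t ≤ x
  · rw [indicator_of_notMem (fun hx => hx.2.not_ge h), indicator_of_mem (mem_Ici.2 h)]
    linarith
  · rw [indicator_of_notMem (s := Ici _) h, mul_zero, add_zero]
    exact mul_le_one₀ (by linarith) (indicator_nonneg (fun _ _ => zero_le_one) _)
      (indicator_le_self' (fun _ _ => zero_le_one) x)

theorem measurable_rho_max : Measurable fun y : ℝ × ℝ => rho c (max y.1 0) y.2 := by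
  have hγ : Measurable fun y : ℝ × ℝ => gamma c (max y.1 0) :=
    ((continuous_gamma_max c).comp continuous_fst).measurable
  have hβ : Measurable fun y : ℝ × ℝ => beta c (max y.1 0) :=
    ((continuous_beta_max c).comp continuous_fst).measurable
  have hIco : Measurable fun y : ℝ × ℝ =>
      (Ico (-(gamma c (max y.1 0))) (beta c (max y.1 0))).indicator (fun _ => (1 : ℝ)) y.2 :=
    (measurable_const (a := (1 : ℝ))).indicator
      ((measurableSet_le hγ.neg measurable_snd).inter (measurableSet_lt measurable_snd hβ))
  have hIci : Measurable fun y : ℝ × ℝ =>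
      (Ici (beta c (max y.1 0))).indicator (fun _ => (1 : ℝ)) y.2 :=
    (measurable_const (a := (1 : ℝ))).indicator (measurableSet_le hβ measurable_snd)
  unfold rho
  fun_prop

variable (c) in
theorem measurableSet_dom : MeasurableSet (dom c) := by
  have hdom : dom c = {y | 0 ≤ y.1 ∧ -(gamma c (max y.1 0)) ≤ y.2} := by
    ext y
    exact and_congr_right fun hy => by rw [max_eq_left hy]
  rw [hdom]
  exact (measurableSet_le measurable_const measurable_fst).inter
    (measurableSet_le ((continuous_gamma_max c).comp continuous_fst).neg.measurable measurable_snd)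

variable (c) in
theorem measurable_dens : Measurable (dens c) := by
  have hdens : dens c = (dom c).indicator fun y => ENNReal.ofReal (rho c (max y.1 0) y.2) :=
    indicator_congr fun y hy => by rw [max_eq_left hy.1]
  rw [hdens]
  exact measurable_rho_max.ennreal_ofReal.indicator (measurableSet_dom c)

variable (c) in
theorem refMeasure_eq_withDensity : refMeasure c = volume.withDensity (dens c) :=
  (withDensity_indicator (measurableSet_dom c) _).symm

variable (c) in
theorem ae_mem_dom : ∀ᵐ y ∂refMeasure c, y ∈ dom c :=
  (withDensity_absolutelyContinuous _ _).ae_le (ae_restrict_mem (measurableSet_dom c))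

theorem integral_refMeasure {f : ℝ × ℝ → ℝ} (hf : Integrable f (refMeasure c)) :
    ∫ y, f y ∂refMeasure c = ∫ t, ∫ x, (dens c (t, x)).toReal * f (t, x) := by
  have htop : ∀ᵐ y : ℝ × ℝ, dens c y < ⊤ := ae_of_all _ dens_lt_top
  rw [refMeasure_eq_withDensity] at hf ⊢
  rw [integrable_withDensity_iff_integrable_smul' (measurable_dens c) htop] at hf
  rw [integral_withDensity_eq_integral_toReal_smul (measurable_dens c) htop]
  exact integral_prod _ hf

theorem dens_le (y : ℝ × ℝ) : dens c y ≤ ENNReal.ofReal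
    (|y.2 + gamma c (max y.1 0)| ^ (c.delta - 1) * Real.exp (-(c.b * y.2 ^ 2 / 2))) := by
  by_cases hy : y ∈ dom c
  · rw [dens_of_mem hy, max_eq_left hy.1]
    exact ENNReal.ofReal_le_ofReal (rho_le _ _)
  · exact dens_of_notMem hy ▸ zero_le

instance : IsFiniteMeasureOnCompacts (refMeasure c) where
  lt_top_of_isCompact K hK := by
    have hcont : Continuous fun y : ℝ × ℝ =>
        |y.2 + gamma c (max y.1 0)| ^ (c.delta - 1) * Real.exp (-(c.b * y.2 ^ 2 / 2)) := by
      have hγ := (continuous_gamma_max c).comp (continuous_fst (X := ℝ) (Y := ℝ))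
      exact ((continuous_snd.add hγ).abs.rpow_const
        fun _ => Or.inr (sub_nonneg.2 Admissible.one_le_delta)).mul (by fun_prop)
    obtain ⟨M, hM⟩ := (hK.image hcont).bddAbove
    rw [refMeasure_eq_withDensity, withDensity_apply' _ K]
    calc ∫⁻ y in K, dens c y ≤ ∫⁻ _ in K, ENNReal.ofReal M :=
          setLIntegral_mono measurable_const fun y hy =>
            (dens_le y).trans (ENNReal.ofReal_le_ofReal (hM (mem_image_of_mem _ hy)))
      _ = ENNReal.ofReal M * volume K := setLIntegral_const _ _
      _ < ⊤ := ENNReal.mul_lt_top ENNReal.ofReal_lt_top hK.measure_lt_top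

theorem dens_le_dens_timeShift (t : ℝ) (y : ℝ × ℝ) : dens c y ≤ dens c (timeShift t y) := by
  by_cases hy : y ∈ dom c
  · have hle : y.1 ≤ y.1 + max t 0 := le_add_of_nonneg_right (le_max_right _ _)
    rw [dens_of_mem hy, dens_of_mem (y := timeShift t y) (mem_dom_of_le hy hle)]
    exact ENNReal.ofReal_le_ofReal (Admissible.rhoMonotone _ _ _ hy.1 hle hy)
  · exact dens_of_notMem hy ▸ zero_le

instance : IsTranslationSubinvariant (refMeasure c) where
  map_timeShift_le t := by
    have hvol : MeasurePreserving (timeShift t) volume volume :=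
      timeShift_eq_add t ▸ measurePreserving_add_right volume _
    refine Measure.le_iff.2 fun A hA => ?_
    rw [Measure.map_apply (measurable_timeShift t) hA, refMeasure_eq_withDensity,
      withDensity_apply _ (measurable_timeShift t hA), withDensity_apply _ hA]
    calc ∫⁻ y in timeShift t ⁻¹' A, dens c y
        ≤ ∫⁻ y in timeShift t ⁻¹' A, dens c (timeShift t y) :=
          setLIntegral_mono ((measurable_dens c).comp (measurable_timeShift t))
            fun y _ => dens_le_dens_timeShift t y
      _ = ∫⁻ y in A, dens c y := hvol.setLIntegral_comp_preimage hA (measurable_dens c)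

end Density

/-! ### Test functions and the time derivative -/

namespace IsC01

variable {u : ℝ × ℝ → ℝ}

theorem hasFDerivAt (hu : IsC01 u) (y : ℝ × ℝ) : HasFDerivAt u (fderiv ℝ u y) (y.1, y.2) :=
  ((hu.1.differentiable one_ne_zero) y).hasFDerivAt

theorem hasDerivAt_fst (hu : IsC01 u) (y : ℝ × ℝ) :
    HasDerivAt (fun t => u (t, y.2)) (fderiv ℝ u y (1, 0)) y.1 :=
  (hu.hasFDerivAt y).comp_hasDerivAt y.1 ((hasDerivAt_id y.1).prodMk (hasDerivAt_const y.1 y.2))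

theorem hasDerivAt_snd (hu : IsC01 u) (y : ℝ × ℝ) :
    HasDerivAt (fun x => u (y.1, x)) (fderiv ℝ u y (0, 1)) y.2 :=
  (hu.hasFDerivAt y).comp_hasDerivAt y.2 ((hasDerivAt_const y.2 y.1).prodMk (hasDerivAt_id y.2))

theorem continuous_fderiv (hu : IsC01 u) (v : ℝ × ℝ) : Continuous fun y => fderiv ℝ u y v :=
  (hu.1.continuous_fderiv one_ne_zero).clm_apply continuous_const

theorem hasCompactSupport_fderiv (hu : IsC01 u) (v : ℝ × ℝ) :
    HasCompactSupport fun y => fderiv ℝ u y v :=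
  (hu.2.fderiv ℝ).comp_left (g := fun L : ℝ × ℝ →L[ℝ] ℝ => L v) rfl

theorem comp_timeShift (hu : IsC01 u) (t : ℝ) : IsC01 (u ∘ timeShift t) := by
  have hshift : timeShift t = Homeomorph.addRight ((max t 0, 0) : ℝ × ℝ) := timeShift_eq_add t
  refine ⟨?_, hshift ▸ hu.2.comp_homeomorph _⟩
  rw [timeShift_eq_add]
  exact hu.1.comp (contDiff_id.add contDiff_const)

end IsC01

theorem abs_inv_smul_timeShift_sub_le {u : ℝ × ℝ → ℝ} {M : NNReal} (hM : LipschitzWith M u)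
    {t : ℝ} (ht : 0 < t) (y : ℝ × ℝ) : |t⁻¹ • (u (timeShift t y) - u y)| ≤ M := by
  have hdist : dist (timeShift t y) y = t := by
    rw [timeShift_of_nonneg ht.le, Prod.dist_eq, dist_self, dist_self_add_left,
      Real.norm_of_nonneg ht.le, max_eq_left ht.le]
  have hlip := hM.dist_le_mul (timeShift t y) y
  rw [hdist, Real.dist_eq] at hlip
  rwa [smul_eq_mul, abs_mul, abs_inv, abs_of_pos ht, inv_mul_le_iff₀ ht, mul_comm]

section TimeDerivative

variable {c : Data} [IsTranslationSubinvariant (refMeasure c)]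

theorem hasTimeDeriv_iff {F K : H c} : HasTimeDeriv c F K ↔
    Tendsto (fun t : ℝ => t⁻¹ • (translate t F - F)) (𝓝[>] 0) (𝓝 K) := by
  rw [Lp.tendsto_Lp_iff_tendsto_eLpNorm', HasTimeDeriv]
  refine tendsto_congr' ?_
  filter_upwards [self_mem_nhdsWithin] with t ht
  refine eLpNorm_congr_ae ?_
  filter_upwards [translate_sub_ae_eq (t := t) (ae_eq_refl F)] with y hy
  rw [Pi.sub_apply, hy, timeShift_of_nonneg (le_of_lt ht), shift, smul_eq_mul, div_eq_inv_mul]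

theorem hasTimeDeriv_of_isC01 [IsFiniteMeasureOnCompacts (refMeasure c)] {u : ℝ × ℝ → ℝ}
    (hu : IsC01 u) {F K : H c} (hF : F =ᵐ[refMeasure c] u)
    (hK : K =ᵐ[refMeasure c] fun y => fderiv ℝ u y (1, 0)) : HasTimeDeriv c F K := by
  rw [hasTimeDeriv_iff]
  obtain ⟨M, hM⟩ := hu.1.lipschitzWith_of_hasCompactSupport hu.2 one_ne_zero
  obtain ⟨S, hS, hsub, hmem⟩ := exists_isCompact_of_timeShift_mem hu.2 1
  have hderiv : ∀ y, |fderiv ℝ u y (1, 0)| ≤ M := fun y => by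
    simpa using (fderiv ℝ u y).le_of_opNorm_le (norm_fderiv_le_of_lipschitz ℝ hM) (1, 0)
  refine tendsto_Lp_of_dominated ENNReal.ofNat_ne_top (bound := S.indicator fun _ => (M + M : ℝ))
    (memLp_indicator_const 2 hS.measurableSet _ (Or.inr hS.measure_lt_top.ne))
    (fun t => translate_sub_ae_eq hF) hK ?_ ?_
  · filter_upwards [Ioo_mem_nhdsGT zero_lt_one] with t ht
    refine ae_of_all _ fun y => ?_
    by_cases hy : y ∈ S
    · rw [indicator_of_mem hy]
      exact norm_sub_le_of_le (abs_inv_smul_timeShift_sub_le hM ht.1 y) (hderiv y)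
    · have hfderiv : fderiv ℝ u y = 0 :=
        image_eq_zero_of_notMem_tsupport fun h => hy (hsub (tsupport_fderiv_subset ℝ h))
      rw [indicator_of_notMem hy, hfderiv,
        image_eq_zero_of_notMem_tsupport fun h => hy (hmem t ht.2.le y h),
        image_eq_zero_of_notMem_tsupport fun h => hy (hsub h)]
      simp
  · refine ae_of_all _ fun y => ?_
    have hslope := (hasDerivAt_iff_tendsto_slope_zero.1 (hu.hasDerivAt_fst y)).mono_left
      (nhdsGT_le_nhdsNE 0)
    refine hslope.congr' ?_
    filter_upwards [self_mem_nhdsWithin] with t ht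
    rw [timeShift_of_nonneg (le_of_lt ht)]

end TimeDerivative

/-! ### The space `𝓥` and its translation semigroup -/

section SpaceV

variable {c : Data}

instance : CompleteSpace (V c) := (Submodule.isClosed_topologicalClosure _).completeSpace_coe

variable (c) in
/-- The embedding `𝓥 → 𝓗` as a continuous linear map. -/
def toHL : V c →L[ℝ] H c := (WithLp.fstL 2 ℝ (H c) (H c)).comp (V c).subtypeL

variable (c) in
/-- The spatial derivative `𝓥 → 𝓗` as a continuous linear map. -/
def dxL : V c →L[ℝ] H c := (WithLp.sndL 2 ℝ (H c) (H c)).comp (V c).subtypeL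

theorem norm_sq_eq (v : V c) : ‖v‖ ^ 2 = ‖toH c v‖ ^ 2 + ‖dx c v‖ ^ 2 :=
  WithLp.prod_norm_sq_eq_of_L2 _

theorem V_ext {v w : V c} (hH : toH c v = toH c w) (hdx : dx c v = dx c w) : v = w :=
  Subtype.ext (WithLp.ofLp_injective 2 (Prod.ext hH hdx))

variable [IsTranslationSubinvariant (refMeasure c)]

/-- The translation `U_t` acting on both components of `𝓗 × 𝓗`. -/
def translateProd (t : ℝ) : WithLp 2 (H c × H c) →L[ℝ] WithLp 2 (H c × H c) :=
  (WithLp.prodContinuousLinearEquiv 2 ℝ (H c) (H c)).symm.toContinuousLinearMap.comp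
    (((translate t).comp (WithLp.fstL 2 ℝ (H c) (H c))).prod
      ((translate t).comp (WithLp.sndL 2 ℝ (H c) (H c))))

theorem norm_translateProd_le (t : ℝ) (v : WithLp 2 (H c × H c)) :
    ‖translateProd t v‖ ≤ ‖v‖ := by
  rw [← sq_le_sq₀ (norm_nonneg _) (norm_nonneg _), WithLp.prod_norm_sq_eq_of_L2,
    WithLp.prod_norm_sq_eq_of_L2]
  exact add_le_add (pow_le_pow_left₀ (norm_nonneg _) (norm_translate_le t _) 2)
    (pow_le_pow_left₀ (norm_nonneg _) (norm_translate_le t _) 2)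

theorem translateProd_mem_gradGraph (t : ℝ) {v : WithLp 2 (H c × H c)} (hv : v ∈ gradGraph c) :
    translateProd t v ∈ gradGraph c := by
  obtain ⟨u, hu, hfst, hsnd⟩ := hv
  exact ⟨u ∘ timeShift t, hu.comp_timeShift t, translate_ae_eq hfst, translate_ae_eq hsnd⟩

theorem translateProd_mem_V (t : ℝ) {v : WithLp 2 (H c × H c)} (hv : v ∈ V c) :
    translateProd t v ∈ V c :=
  map_mem_closure (translateProd t).continuous hv fun _ => translateProd_mem_gradGraph t

theorem continuous_translateProd [IsFiniteMeasureOnCompacts (refMeasure c)]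
    {v : WithLp 2 (H c × H c)} (hv : v ∈ V c) : Continuous fun t => translateProd t v := by
  refine continuous_of_uniform_approx_of_continuous fun s hs => ?_
  obtain ⟨ε, hε, hs⟩ := Metric.mem_uniformity_dist.1 hs
  obtain ⟨w, ⟨u, hu, hfst, hsnd⟩, hvw⟩ := Metric.mem_closure_iff.1 hv ε hε
  refine ⟨fun t => translateProd t w, ?_, fun t => hs ?_⟩
  · have hsnd' : w.snd =ᵐ[refMeasure c] fun y => fderiv ℝ u y (0, 1) :=
      hsnd.trans (ae_of_all _ fun y => (hu.hasDerivAt_snd y).deriv)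
    exact (WithLp.prod_continuous_toLp 2 _ _).comp
      ((continuous_translate_of_continuous ENNReal.ofNat_ne_top hu.1.continuous hu.2 hfst).prodMk
        (continuous_translate_of_continuous ENNReal.ofNat_ne_top (hu.continuous_fderiv _)
          (hu.hasCompactSupport_fderiv _) hsnd'))
  · rw [dist_eq_norm, ← map_sub]
    exact (norm_translateProd_le t _).trans_lt (dist_eq_norm v w ▸ hvw)

/-- The orbit of `v ∈ 𝓥` under the translation semigroup. -/
def orbit (v : V c) (t : ℝ) : V c := ⟨translateProd t v, translateProd_mem_V t v.2⟩

theorem orbit_zero (v : V c) : orbit v 0 = v := V_ext (translate_zero _) (translate_zero _)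

variable [IsFiniteMeasureOnCompacts (refMeasure c)]

theorem continuous_orbit (v : V c) : Continuous (orbit v) :=
  (continuous_translateProd v.2).subtype_mk _

theorem hasTimeDeriv_integral_orbit (v : V c) {h : ℝ} (hh : 0 ≤ h) :
    HasTimeDeriv c (toH c (∫ s in (0 : ℝ)..h, orbit v s)) (translate h (toH c v) - toH c v) := by
  have hcont : Continuous fun s => translate s (toH c v) :=
    (toHL c).continuous.comp (continuous_orbit v)
  have hint (a b) : IntervalIntegrable (fun s => translate s (toH c v)) volume a b :=
    hcont.intervalIntegrable a b
  have htoH : toH c (∫ s in (0 : ℝ)..h, orbit v s) = ∫ s in (0 : ℝ)..h, translate s (toH c v) :=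
    ((toHL c).intervalIntegral_comp_comm ((continuous_orbit v).intervalIntegrable 0 h)).symm
  have htranslate {t : ℝ} (ht : 0 ≤ t) : translate t (∫ s in (0 : ℝ)..h, translate s (toH c v)) =
      ∫ s in t..(h + t), translate s (toH c v) := by
    have hshift := intervalIntegral.integral_comp_add_right (a := 0) (b := h)
      (fun s => translate s (toH c v)) t
    rw [zero_add] at hshift
    rw [← (translate t).intervalIntegral_comp_comm (hint 0 h), ← hshift]
    refine intervalIntegral.integral_congr fun s hs => ?_
    rw [uIcc_of_le hh] at hs
    exact translate_translate ht hs.1 _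
  have hslope_zero := tendsto_inv_smul_integral hcont 0
  rw [translate_zero] at hslope_zero
  rw [htoH, hasTimeDeriv_iff]
  refine ((tendsto_inv_smul_integral hcont h).sub hslope_zero).congr' ?_
  filter_upwards [self_mem_nhdsWithin] with t ht
  rw [htranslate (le_of_lt ht), ← smul_sub, zero_add,
    intervalIntegral.integral_interval_sub_interval_comm' (hint _ _) (hint _ _) (hint _ _)]

end SpaceV

/-! ### Existence and uniqueness of the resolvent -/

section Resolvent

variable {c : Data} {α : ℝ}

variable (c) in
/-- The bilinear form `𝓐(u, v) + α (u, v)_𝓗` on `𝓥`. -/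
def formAlpha (α : ℝ) : V c →L[ℝ] V c →L[ℝ] ℝ :=
  (c.sigma ^ 2 / 8) • (innerSL ℝ).bilinearComp (dxL c) (dxL c) +
    α • (innerSL ℝ).bilinearComp (toHL c) (toHL c)

theorem formAlpha_apply (u v : V c) :
    formAlpha c α u v = formA c u v + α * inner ℝ (toH c u) (toH c v) := rfl

theorem isCoercive_formAlpha (hσ : 0 < c.sigma) (hα : 0 < α) : IsCoercive (formAlpha c α) := by
  refine ⟨min (c.sigma ^ 2 / 8) α, lt_min (by positivity) hα, fun u => ?_⟩
  rw [formAlpha_apply, formA, real_inner_self_eq_norm_sq, real_inner_self_eq_norm_sq, mul_assoc,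
    ← sq, norm_sq_eq, mul_add, add_comm]
  gcongr
  · exact min_le_left _ _
  · exact min_le_right _ _

variable [IsTranslationSubinvariant (refMeasure c)]

variable (c) in
/-- The graph of `∂ₜ` on `D(∂ₜ, 𝓗) ∩ 𝓥` as a subspace of `𝓥 × 𝓥'`; its closure is
`timeGraph c`. -/
def timeCore : Submodule ℝ (V c × StrongDual ℝ (V c)) where
  carrier := {q | ∃ K : H c, HasTimeDeriv c (toH c q.1) K ∧
    ∀ w : V c, q.2 w = inner ℝ K (toH c w)}
  zero_mem' := by
    refine ⟨0, hasTimeDeriv_iff.2 ?_, fun w => (inner_zero_left _).symm⟩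
    have hzero : toH c (0 : V c) = 0 := rfl
    simp [hzero]
  add_mem' := by
    rintro q r ⟨K, hqK, hq⟩ ⟨L, hrL, hr⟩
    refine ⟨K + L, hasTimeDeriv_iff.2 ?_, fun w => ?_⟩
    · refine ((hasTimeDeriv_iff.1 hqK).add (hasTimeDeriv_iff.1 hrL)).congr fun t => ?_
      have hadd : toH c (q + r).1 = toH c q.1 + toH c r.1 := rfl
      rw [hadd, map_add, ← smul_add, add_sub_add_comm]
    · rw [inner_add_left, ← hq, ← hr]
      rfl
  smul_mem' := by
    rintro a q ⟨K, hqK, hq⟩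
    refine ⟨a • K, hasTimeDeriv_iff.2 ?_, fun w => ?_⟩
    · refine ((hasTimeDeriv_iff.1 hqK).const_smul a).congr fun t => ?_
      have hsmul : toH c (a • q).1 = a • toH c q.1 := rfl
      rw [hsmul, map_smul, ← smul_sub, smul_comm]
    · rw [real_inner_smul_left, ← hq]
      rfl

theorem apply_nonpos_of_mem_timeCore {q : V c × StrongDual ℝ (V c)} (hq : q ∈ timeCore c) :
    q.2 q.1 ≤ 0 := by
  obtain ⟨K, hK, hqK⟩ := hq
  rw [hqK]
  refine le_of_tendsto ((hasTimeDeriv_iff.1 hK).inner tendsto_const_nhds) ?_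
  filter_upwards [self_mem_nhdsWithin] with t ht
  rw [real_inner_smul_left]
  exact mul_nonpos_of_nonneg_of_nonpos (inv_pos.2 ht).le (inner_translate_sub_nonpos t _)

theorem apply_nonpos_of_mem_timeGraph {q : V c × StrongDual ℝ (V c)} (hq : q ∈ timeGraph c) :
    q.2 q.1 ≤ 0 :=
  apply_nonpos_of_mem_topologicalClosure (G := timeCore c)
    (fun _ => apply_nonpos_of_mem_timeCore) hq

theorem isResolvent_iff {f g : H c} : IsResolvent c α f g ↔
    ∃ q ∈ (timeCore c).topologicalClosure, toH c q.1 = g ∧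
      formAlpha c α q.1 - q.2 = (innerSL ℝ f).comp (toHL c) := by
  refine exists_congr fun q => and_congr_right fun _ => and_congr_right fun _ => ?_
  rw [ContinuousLinearMap.ext_iff]
  refine forall_congr' fun v => ?_
  rw [sub_apply, formAlpha_apply, formE, sub_add_eq_add_sub]
  rfl

theorem IsResolvent.sub {f f' g g' : H c} (h : IsResolvent c α f g)
    (h' : IsResolvent c α f' g') : IsResolvent c α (f - f') (g - g') := by
  obtain ⟨q, hq, rfl, hqf⟩ := isResolvent_iff.1 h
  obtain ⟨q', hq', rfl, hqf'⟩ := isResolvent_iff.1 h'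
  refine isResolvent_iff.2 ⟨q - q', sub_mem hq hq', rfl, ?_⟩
  rw [map_sub, ContinuousLinearMap.sub_comp, ← hqf, ← hqf', Prod.fst_sub, Prod.snd_sub, map_sub,
    sub_sub_sub_comm]

theorem IsResolvent.smul {f g : H c} (r : ℝ) (h : IsResolvent c α f g) :
    IsResolvent c α (r • f) (r • g) := by
  obtain ⟨q, hq, rfl, hqf⟩ := isResolvent_iff.1 h
  refine isResolvent_iff.2 ⟨r • q, (timeCore c).topologicalClosure.smul_mem r hq, rfl, ?_⟩
  rw [map_smul, ContinuousLinearMap.smul_comp, ← hqf, Prod.smul_fst, Prod.smul_snd, map_smul,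
    smul_sub]

theorem IsResolvent.norm_le {f g : H c} (hα : 0 < α) (h : IsResolvent c α f g) :
    ‖g‖ ≤ α⁻¹ * ‖f‖ := by
  obtain ⟨q, hq, rfl, hqf⟩ := h
  have henergy : α * ‖toH c q.1‖ * ‖toH c q.1‖ ≤ ‖f‖ * ‖toH c q.1‖ := by
    have hA : 0 ≤ formA c q.1 q.1 := mul_nonneg (by positivity) real_inner_self_nonneg
    have heq := hqf q.1
    rw [formE, real_inner_self_eq_norm_mul_norm] at heq
    linarith [apply_nonpos_of_mem_timeGraph hq, real_inner_le_norm f (toH c q.1)]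
  rw [le_inv_mul_iff₀ hα]
  rcases (norm_nonneg (toH c q.1)).eq_or_lt with hzero | hpos
  · rw [← hzero, mul_zero]
    exact norm_nonneg f
  · exact le_of_mul_le_mul_right henergy hpos

theorem IsResolvent.unique {f g g' : H c} (hα : 0 < α) (h : IsResolvent c α f g)
    (h' : IsResolvent c α f g') : g = g' := by
  have hnorm := (h.sub h').norm_le hα
  rw [sub_self, norm_zero, mul_zero] at hnorm
  exact sub_eq_zero.1 (norm_le_zero_iff.1 hnorm)

variable [IsFiniteMeasureOnCompacts (refMeasure c)]

/-- Test with the averages of the orbit of `v` over `[0, h]`, which lie in `D(∂ₜ, 𝓗) ∩ 𝓥`, and let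
`h` tend to `0`. -/
theorem eq_zero_of_formAlpha_eq_apply {v : V c} (hα : IsCoercive (formAlpha c α))
    (hv : ∀ q ∈ timeCore c, formAlpha c α q.1 v = q.2 v) : v = 0 := by
  have hintegral (h : ℝ) (hh : 0 ≤ h) :
      formAlpha c α (∫ s in (0 : ℝ)..h, orbit v s) v ≤ 0 := by
    rw [hv (∫ s in (0 : ℝ)..h, orbit v s,
      (innerSL ℝ (translate h (toH c v) - toH c v)).comp (toHL c))
      ⟨_, hasTimeDeriv_integral_orbit v hh, fun w => rfl⟩]
    exact inner_translate_sub_nonpos h (toH c v)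
  have haverage : Tendsto (fun h : ℝ => h⁻¹ • ∫ s in (0 : ℝ)..h, orbit v s) (𝓝[>] 0) (𝓝 v) := by
    simpa only [orbit_zero, zero_add] using tendsto_inv_smul_integral (continuous_orbit v) 0
  have hself : formAlpha c α v v ≤ 0 := by
    have hcont : Continuous fun u => formAlpha c α u v := by fun_prop
    refine le_of_tendsto ((hcont.tendsto v).comp haverage) ?_
    filter_upwards [self_mem_nhdsWithin] with h hh
    rw [Function.comp_apply, map_smul]
    exact mul_nonpos_of_nonneg_of_nonpos (inv_pos.2 hh).le (hintegral h (le_of_lt hh))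
  obtain ⟨C, hC, hcoercive⟩ := hα
  have hsq : ‖v‖ * ‖v‖ ≤ 0 := by
    have := (hcoercive v).trans hself
    rw [mul_assoc] at this
    exact nonpos_of_mul_nonpos_right this hC
  exact norm_eq_zero.1 (mul_self_eq_zero.1 (le_antisymm hsq (mul_self_nonneg _)))

theorem exists_isResolvent (hσ : 0 < c.sigma) (hα : 0 < α) (f : H c) :
    ∃ g, IsResolvent c α f g := by
  have hcoercive := isCoercive_formAlpha hσ hα
  obtain ⟨q, hq, hqf⟩ := exists_mem_closure_sub_eq_of_isCoercive hcoercive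
    (fun _ => apply_nonpos_of_mem_timeCore)
    (fun _ => eq_zero_of_formAlpha_eq_apply hcoercive) ((innerSL ℝ f).comp (toHL c))
  exact ⟨_, isResolvent_iff.2 ⟨q, hq, rfl, hqf⟩⟩

theorem existsUnique_isResolvent (hσ : 0 < c.sigma) (hα : 0 < α) (f : H c) :
    ∃! g, IsResolvent c α f g :=
  existsUnique_of_exists_of_unique (exists_isResolvent hσ hα f) fun _ _ => IsResolvent.unique hα

theorem isResolvent_resolvent (hσ : 0 < c.sigma) (hα : 0 < α) (f : H c) :
    IsResolvent c α f (resolvent c α f) :=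
  Classical.epsilon_spec (exists_isResolvent hσ hα f)

theorem lipschitzWith_resolvent (hσ : 0 < c.sigma) (hα : 0 < α) :
    LipschitzWith (Real.toNNReal α⁻¹) (resolvent c α) := by
  refine LipschitzWith.of_dist_le_mul fun f g => ?_
  rw [dist_eq_norm, dist_eq_norm, Real.coe_toNNReal _ (inv_pos.2 hα).le]
  exact ((isResolvent_resolvent hσ hα f).sub (isResolvent_resolvent hσ hα g)).norm_le hα

end Resolvent

/-! ### The resolvent is sub-Markovian -/

section SubMarkov

variable {c : Data}

section Contraction

variable (g : C(ℝ, unitInterval))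

/-- The map `(F, K) ↦ (φ(F), φ'(F) K)` on `𝓗 × 𝓗`, where `φ` is the normal contraction with
derivative `g`. -/
def contractionProd (v : WithLp 2 (H c × H c)) : WithLp 2 (H c × H c) :=
  WithLp.toLp 2 (compContraction g v.fst, mulComp g v.fst v.snd)

theorem continuous_contractionProd :
    Continuous (contractionProd g : WithLp 2 (H c × H c) → WithLp 2 (H c × H c)) :=
  (WithLp.prod_continuous_toLp 2 _ _).comp
    (((continuous_compContraction g).comp (WithLp.continuous_fst 2 _ _)).prodMk
      ((continuous_mulComp g).comp (WithLp.prod_continuous_ofLp 2 _ _)))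

theorem contractionProd_mem_gradGraph {v : WithLp 2 (H c × H c)} (hv : v ∈ gradGraph c) :
    contractionProd g v ∈ gradGraph c := by
  obtain ⟨u, hu, hfst, hsnd⟩ := hv
  refine ⟨normalContraction g ∘ u, ⟨(contDiff_normalContraction g).comp hu.1,
    hu.2.comp_left (normalContraction_zero g)⟩, ?_, ?_⟩
  · filter_upwards [coeFn_compContraction g v.fst, hfst] with y hcomp hy
    exact hcomp.trans (congrArg (normalContraction g) hy)
  · filter_upwards [coeFn_mulComp g v.fst v.snd, hfst, hsnd] with y hmul hy hdx
    refine hmul.trans ?_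
    rw [hy, hdx, (hu.hasDerivAt_snd y).deriv]
    exact ((hasDerivAt_normalContraction g (u y)).comp y.2 (hu.hasDerivAt_snd y)).deriv.symm

theorem contractionProd_mem_V {v : WithLp 2 (H c × H c)} (hv : v ∈ V c) :
    contractionProd g v ∈ V c :=
  map_mem_closure (continuous_contractionProd g) hv fun _ => contractionProd_mem_gradGraph g

/-- `u ↦ φ(u)` on `𝓥`, where `φ` is the normal contraction with derivative `g`. -/
def contractionV (v : V c) : V c := ⟨contractionProd g v, contractionProd_mem_V g v.2⟩

theorem continuous_contractionV : Continuous (contractionV g : V c → V c) :=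
  ((continuous_contractionProd g).comp continuous_subtype_val).subtype_mk _

theorem formA_contractionV_nonneg (v : V c) : 0 ≤ formA c v (contractionV g v) :=
  mul_nonneg (by positivity) (inner_mulComp_nonneg g (toH c v) (dx c v))

variable [IsTranslationSubinvariant (refMeasure c)]

theorem apply_contractionV_nonpos_of_mem_timeGraph {q : V c × StrongDual ℝ (V c)}
    (hq : q ∈ timeGraph c) : q.2 (contractionV g q.1) ≤ 0 := by
  refine closure_minimal (t := {q : V c × StrongDual ℝ (V c) | q.2 (contractionV g q.1) ≤ 0}) ?_
    (isClosed_le (continuous_snd.clm_apply ((continuous_contractionV g).comp continuous_fst))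
      continuous_const) hq
  rintro q ⟨K, hK, hqK⟩
  rw [mem_ofPred_eq, hqK]
  refine le_of_tendsto ((hasTimeDeriv_iff.1 hK).inner tendsto_const_nhds) ?_
  filter_upwards [self_mem_nhdsWithin] with t ht
  rw [real_inner_smul_left]
  exact mul_nonpos_of_nonneg_of_nonpos (inv_pos.2 ht).le
    (inner_translate_sub_compContraction_nonpos g t _)

theorem IsResolvent.inner_compContraction_nonpos {α : ℝ} {f F : H c} (h : IsResolvent c α f F) :
    inner ℝ (α • F - f) (compContraction g F) ≤ 0 := by
  obtain ⟨q, hq, rfl, hqf⟩ := h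
  have heq : formA c q.1 (contractionV g q.1) - q.2 (contractionV g q.1) +
      α * inner ℝ (toH c q.1) (compContraction g (toH c q.1)) =
      inner ℝ f (compContraction g (toH c q.1)) := hqf (contractionV g q.1)
  rw [inner_sub_left, real_inner_smul_left]
  linarith [apply_contractionV_nonpos_of_mem_timeGraph g hq, formA_contractionV_nonneg g q.1]

end Contraction

variable [IsTranslationSubinvariant (refMeasure c)] {α : ℝ}

theorem IsResolvent.ae_le {k : ℝ} (hα : 0 < α) (hk : 0 ≤ k) {f F : H c}
    (h : IsResolvent c α f F) (hf : ∀ᵐ y ∂refMeasure c, f y ≤ α * k) :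
    ∀ᵐ y ∂refMeasure c, F y ≤ k :=
  ae_le_of_inner_compContraction_ramp_nonpos hα hk hf (h.inner_compContraction_nonpos _)

theorem IsResolvent.ae_nonneg (hα : 0 < α) {f F : H c} (h : IsResolvent c α f F)
    (hf : ∀ᵐ y ∂refMeasure c, 0 ≤ f y) : ∀ᵐ y ∂refMeasure c, 0 ≤ F y := by
  have hle : ∀ᵐ y ∂refMeasure c, (-F : H c) y ≤ 0 := by
    have hneg : IsResolvent c α (-f) (-F) := by simpa only [neg_one_smul] using h.smul (-1)
    refine hneg.ae_le hα le_rfl ?_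
    filter_upwards [hf, Lp.coeFn_neg f] with y hy hcoe
    rwa [hcoe, Pi.neg_apply, mul_zero, neg_nonpos]
  filter_upwards [hle, Lp.coeFn_neg F] with y hy hcoe
  rwa [hcoe, Pi.neg_apply, neg_nonpos] at hy

theorem IsResolvent.ae_mono (hα : 0 < α) {f f' F F' : H c} (h : IsResolvent c α f F)
    (h' : IsResolvent c α f' F') (hf : ∀ᵐ y ∂refMeasure c, f y ≤ f' y) :
    ∀ᵐ y ∂refMeasure c, F y ≤ F' y := by
  have hnonneg : ∀ᵐ y ∂refMeasure c, 0 ≤ (F' - F : H c) y := by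
    refine (h'.sub h).ae_nonneg hα ?_
    filter_upwards [hf, Lp.coeFn_sub f' f] with y hy hsub
    rwa [hsub, Pi.sub_apply, sub_nonneg]
  filter_upwards [hnonneg, Lp.coeFn_sub F' F] with y hy hsub
  rwa [hsub, Pi.sub_apply, sub_nonneg] at hy

theorem isSubMarkovian_smul_resolvent [IsFiniteMeasureOnCompacts (refMeasure c)]
    (hσ : 0 < c.sigma) (hα : 0 < α) : IsSubMarkovian c fun f => α • resolvent c α f := by
  intro f hf
  have h := isResolvent_resolvent hσ hα f
  filter_upwards [h.ae_nonneg hα (hf.mono fun _ hy => hy.1),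
    h.ae_le hα (inv_pos.2 hα).le (hf.mono fun _ hy => hy.2.trans_eq (mul_inv_cancel₀ hα.ne').symm),
    Lp.coeFn_smul α (resolvent c α f)] with y hnonneg hle hsmul
  rw [hsmul, Pi.smul_apply, smul_eq_mul]
  exact ⟨mul_nonneg hα.le hnonneg, by rwa [← le_inv_mul_iff₀ hα, mul_one]⟩

end SubMarkov

/-! ### Barrier functions -/

section Bump

theorem deriv_eq_zero_off_annulus {f : ℝ → ℝ} (hf : Differentiable ℝ f) {k₁ k₂ : ℝ}
    (h₁ : ∀ y, |y| ≤ 1 → f y = k₁) (h₂ : ∀ y, 2 ≤ |y| → f y = k₂) {y : ℝ}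
    (hy : |y| ≤ 1 ∨ 2 ≤ |y|) : deriv f y = 0 := by
  have hconst {s : Set ℝ} (hs : UniqueDiffOn ℝ s) {k : ℝ} (hk : EqOn f (fun _ => k) s)
      (hys : y ∈ s) : deriv f y = 0 := by
    rw [← (hf y).derivWithin (hs y hys), derivWithin_congr hk (hk hys), derivWithin_fun_const]
    rfl
  rcases hy with hy | hy
  · exact hconst (uniqueDiffOn_Icc (by norm_num)) (fun z hz => h₁ z (abs_le.2 hz)) (abs_le.1 hy)
  · rcases le_abs'.1 hy with hle | hge
    · exact hconst (uniqueDiffOn_Iic (-2)) (fun z hz => h₂ z (le_abs'.2 (Or.inl hz))) hle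
    · exact hconst (uniqueDiffOn_Ici 2) (fun z hz => h₂ z (le_abs'.2 (Or.inr hz))) hge

/-- A smooth even cut-off function: `1` on `[-1, 1]` and `0` off `(-2, 2)`. -/
def bump (y : ℝ) : ℝ := Real.smoothTransition ((4 - y ^ 2) / 3)

theorem contDiff_bump {n : ℕ∞} : ContDiff ℝ n bump :=
  Real.smoothTransition.contDiff.comp (by fun_prop)

theorem bump_nonneg (y : ℝ) : 0 ≤ bump y := Real.smoothTransition.nonneg _

theorem bump_le_one (y : ℝ) : bump y ≤ 1 := Real.smoothTransition.le_one _

theorem bump_eq_one {y : ℝ} (hy : |y| ≤ 1) : bump y = 1 :=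
  Real.smoothTransition.one_of_one_le (by linarith [(sq_le_one_iff_abs_le_one y).2 hy])

theorem bump_eq_zero {y : ℝ} (hy : 2 ≤ |y|) : bump y = 0 :=
  Real.smoothTransition.zero_of_nonpos (by nlinarith [sq_abs y])

theorem differentiable_bump : Differentiable ℝ bump :=
  (contDiff_bump (n := 1)).differentiable one_ne_zero

theorem contDiff_deriv_bump : ContDiff ℝ 1 (deriv bump) :=
  (contDiff_succ_iff_deriv (n := 1).1 (contDiff_bump (n := 2))).2.2

theorem continuous_deriv_deriv_bump : Continuous (deriv (deriv bump)) :=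
  contDiff_deriv_bump.continuous_deriv le_rfl

theorem deriv_bump_eq_zero {y : ℝ} (hy : |y| ≤ 1 ∨ 2 ≤ |y|) : deriv bump y = 0 :=
  deriv_eq_zero_off_annulus differentiable_bump (fun _ => bump_eq_one) (fun _ => bump_eq_zero) hy

theorem deriv_deriv_bump_eq_zero {y : ℝ} (hy : |y| ≤ 1 ∨ 2 ≤ |y|) : deriv (deriv bump) y = 0 :=
  deriv_eq_zero_off_annulus (contDiff_deriv_bump.differentiable one_ne_zero)
    (fun _ hz => deriv_bump_eq_zero (Or.inl hz)) (fun _ hz => deriv_bump_eq_zero (Or.inr hz)) hy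

theorem deriv_bump_nonpos {y : ℝ} (hy : 0 ≤ y) : deriv bump y ≤ 0 := by
  have hanti : AntitoneOn bump (Ici 0) := fun a ha b _ hab =>
    Real.smoothTransition.monotone (by gcongr)
  rw [← (differentiable_bump y).derivWithin (uniqueDiffOn_Ici 0 y hy)]
  exact hanti.derivWithin_nonpos

theorem exists_bound_deriv_bump :
    ∃ C : ℝ, ∀ y, |deriv bump y| ≤ C ∧ |deriv (deriv bump) y| ≤ C := by
  have hsupp {f : ℝ → ℝ} (hf : ∀ y, 2 ≤ |y| → f y = 0) : HasCompactSupport f :=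
    HasCompactSupport.intro (isCompact_Icc (a := -2) (b := 2)) fun y hy =>
      hf y (le_of_not_ge fun hle => hy (abs_le.1 hle))
  obtain ⟨C, hC⟩ := contDiff_deriv_bump.continuous.bounded_above_of_compact_support
    (hsupp fun y hy => deriv_bump_eq_zero (Or.inr hy))
  obtain ⟨D, hD⟩ := continuous_deriv_deriv_bump.bounded_above_of_compact_support
    (hsupp fun y hy => deriv_deriv_bump_eq_zero (Or.inr hy))
  exact ⟨max C D, fun y => ⟨(hC y).trans (le_max_left _ _), (hD y).trans (le_max_right _ _)⟩⟩

theorem hasDerivAt_bump_div (R x : ℝ) :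
    HasDerivAt (fun x => bump (x / R)) (deriv bump (x / R) / R) x := by
  simpa only [Function.comp_def, id_eq, mul_one_div] using
    (differentiable_bump (x / R)).hasDerivAt.comp x ((hasDerivAt_id x).div_const R)

theorem hasDerivAt_deriv_bump_div (R x : ℝ) :
    HasDerivAt (fun x => deriv bump (x / R) / R) (deriv (deriv bump) (x / R) / R / R) x := by
  simpa only [Function.comp_def, id_eq, mul_one_div] using
    ((contDiff_deriv_bump.differentiable one_ne_zero (x / R)).hasDerivAt.comp x
      ((hasDerivAt_id x).div_const R)).div_const R

end Bump

section Barrier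

/-- The space-time cut-off at time scale `T` and space scale `R`. -/
def barrier (T R : ℝ) (y : ℝ × ℝ) : ℝ := bump (y.1 / T) * bump (y.2 / R)

/-- `ρ⁻¹ ∂ₓ(ρ ∂ₓw)` for the barrier `w`. The truncations only matter off the domain and off the
support of `∂ₓw`; they make the function continuous on `ℝ²`. -/
def barrierDiffusion (c : Data) (T R : ℝ) (y : ℝ × ℝ) : ℝ :=
  bump (y.1 / T) * (deriv (deriv bump) (y.2 / R) / R / R +
    deriv bump (y.2 / R) / R * ((c.delta - 1) / max (y.2 + gamma c (max y.1 0)) R - c.b * y.2))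

/-- The rectangle `|t| ≤ 2T`, `|x| ≤ 2R`, which contains the support of the barrier. -/
def barrierBox (T R : ℝ) : Set (ℝ × ℝ) := Icc (-(2 * T)) (2 * T) ×ˢ Icc (-(2 * R)) (2 * R)

theorem isCompact_barrierBox (T R : ℝ) : IsCompact (barrierBox T R) :=
  isCompact_Icc.prod isCompact_Icc

variable {c : Data} {T R : ℝ}

theorem two_le_abs_div_of_notMem_barrierBox (hT : 0 < T) (hR : 0 < R) {y : ℝ × ℝ}
    (hy : y ∉ barrierBox T R) : 2 ≤ |y.1 / T| ∨ 2 ≤ |y.2 / R| := by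
  contrapose! hy
  rw [abs_div, abs_div, abs_of_pos hT, abs_of_pos hR, div_lt_iff₀ hT, div_lt_iff₀ hR] at hy
  exact ⟨abs_le.1 hy.1.le, abs_le.1 hy.2.le⟩

theorem barrier_eq_zero (hT : 0 < T) (hR : 0 < R) {y : ℝ × ℝ} (hy : y ∉ barrierBox T R) :
    barrier T R y = 0 :=
  mul_eq_zero.2 ((two_le_abs_div_of_notMem_barrierBox hT hR hy).imp bump_eq_zero bump_eq_zero)

theorem barrier_eq_one (hT : 0 < T) (hR : 0 < R) {y : ℝ × ℝ} (ht : |y.1| ≤ T) (hx : |y.2| ≤ R) :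
    barrier T R y = 1 := by
  rw [barrier, bump_eq_one, bump_eq_one, one_mul]
  · rwa [abs_div, abs_of_pos hR, div_le_one hR]
  · rwa [abs_div, abs_of_pos hT, div_le_one hT]

theorem barrierDiffusion_eq_zero (hT : 0 < T) (hR : 0 < R) {y : ℝ × ℝ}
    (hy : y ∉ barrierBox T R) : barrierDiffusion c T R y = 0 := by
  rcases two_le_abs_div_of_notMem_barrierBox hT hR hy with ht | hx
  · rw [barrierDiffusion, bump_eq_zero ht, zero_mul]
  · rw [barrierDiffusion, deriv_bump_eq_zero (Or.inr hx), deriv_deriv_bump_eq_zero (Or.inr hx),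
      zero_div, zero_div, zero_mul, add_zero, mul_zero]

theorem isC01_barrier (hT : 0 < T) (hR : 0 < R) : IsC01 (barrier T R) :=
  ⟨((contDiff_bump (n := 1)).comp (contDiff_fst.div_const T)).mul
    ((contDiff_bump (n := 1)).comp (contDiff_snd.div_const R)),
    HasCompactSupport.intro (isCompact_barrierBox T R) fun _ => barrier_eq_zero hT hR⟩

theorem fderiv_barrier_fst (hT : 0 < T) (hR : 0 < R) (y : ℝ × ℝ) :
    fderiv ℝ (barrier T R) y (1, 0) = deriv bump (y.1 / T) / T * bump (y.2 / R) :=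
  ((isC01_barrier hT hR).hasDerivAt_fst y).unique
    ((hasDerivAt_bump_div T y.1).mul_const (bump (y.2 / R)))

theorem fderiv_barrier_snd (hT : 0 < T) (hR : 0 < R) (y : ℝ × ℝ) :
    fderiv ℝ (barrier T R) y (0, 1) = bump (y.1 / T) * (deriv bump (y.2 / R) / R) :=
  ((isC01_barrier hT hR).hasDerivAt_snd y).unique
    ((hasDerivAt_bump_div R y.2).const_mul (bump (y.1 / T)))

theorem continuous_barrierDiffusion [Admissible c] (hR : 0 < R) :
    Continuous (barrierDiffusion c T R) := by
  have hbump : Continuous bump := differentiable_bump.continuous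
  have hderiv : Continuous (deriv bump) := contDiff_deriv_bump.continuous
  have hderiv₂ := continuous_deriv_deriv_bump
  have hgamma : Continuous fun y : ℝ × ℝ => gamma c (max y.1 0) :=
    (continuous_gamma_max c).comp continuous_fst
  have hdiv : Continuous fun y : ℝ × ℝ =>
      (c.delta - 1) / max (y.2 + gamma c (max y.1 0)) R :=
    continuous_const.div (by fun_prop) fun y => (lt_max_of_lt_right hR).ne'
  unfold barrierDiffusion
  fun_prop

theorem hasCompactSupport_barrierDiffusion (hT : 0 < T) (hR : 0 < R) :
    HasCompactSupport (barrierDiffusion c T R) :=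
  HasCompactSupport.intro (isCompact_barrierBox T R) fun _ => barrierDiffusion_eq_zero hT hR

end Barrier

section BarrierBounds

variable {c : Data} {T R C : ℝ}

theorem abs_fderiv_barrier_fst_le (hC : ∀ y, |deriv bump y| ≤ C) (hT : 0 < T) (hR : 0 < R)
    (y : ℝ × ℝ) : |fderiv ℝ (barrier T R) y (1, 0)| ≤ C / T := by
  rw [fderiv_barrier_fst hT hR, abs_mul, abs_div, abs_of_pos hT, abs_of_nonneg (bump_nonneg _)]
  exact (mul_le_of_le_one_right (by positivity) (bump_le_one _)).trans (by gcongr; exact hC _)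

-- For `x > R` the drift `-b x` has the favourable sign and `(δ - 1) / s ≤ (δ - 1) / R`.
theorem neg_le_diffusion_bump_div {δ b s x : ℝ}
    (hC : ∀ y, |deriv bump y| ≤ C ∧ |deriv (deriv bump) y| ≤ C) (hδ : 1 ≤ δ) (hb : 0 ≤ b)
    (hR : 0 < R) (hs : R ≤ s) (hx : -R ≤ x) :
    -(C * δ / R ^ 2) ≤ deriv (deriv bump) (x / R) / R / R +
      deriv bump (x / R) / R * ((δ - 1) / s - b * x) := by
  have hC0 : 0 ≤ C := (abs_nonneg _).trans (hC 0).1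
  rcases le_or_gt x R with hxR | hxR
  · have habs : |x / R| ≤ 1 := by
      rw [abs_div, abs_of_pos hR, div_le_one hR]
      exact abs_le.2 ⟨hx, hxR⟩
    rw [deriv_bump_eq_zero (Or.inl habs), deriv_deriv_bump_eq_zero (Or.inl habs), zero_div,
      zero_div, zero_mul, add_zero]
    exact neg_nonpos.2 (by positivity)
  have hx0 : 0 < x := hR.trans hxR
  have hderiv : deriv bump (x / R) / R ≤ 0 :=
    div_nonpos_of_nonpos_of_nonneg (deriv_bump_nonpos (by positivity)) hR.le
  have hdrift : (δ - 1) / s - b * x ≤ (δ - 1) / R := by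
    have hle : (δ - 1) / s ≤ (δ - 1) / R :=
      div_le_div_of_nonneg_left (sub_nonneg.2 hδ) hR hs
    linarith [mul_nonneg hb hx0.le]
  calc -(C * δ / R ^ 2) = -C / R / R + -C / R * ((δ - 1) / R) := by field_simp; ring
    _ ≤ deriv (deriv bump) (x / R) / R / R + deriv bump (x / R) / R * ((δ - 1) / R) := by
        refine add_le_add ?_ (mul_le_mul_of_nonneg_right ?_ (div_nonneg (sub_nonneg.2 hδ) hR.le))
        · gcongr
          exact neg_le_of_abs_le (hC _).2
        · gcongr
          exact neg_le_of_abs_le (hC _).1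
    _ ≤ _ := add_le_add le_rfl (mul_le_mul_of_nonpos_left hdrift hderiv)

theorem neg_le_barrierDiffusion (hC : ∀ y, |deriv bump y| ≤ C ∧ |deriv (deriv bump) y| ≤ C)
    (hδ : 1 ≤ c.delta) (hb : 0 ≤ c.b) (hT : 1 ≤ T) (hTR : T ≤ R) {y : ℝ × ℝ} (hy : -R ≤ y.2) :
    -(C * c.delta / T) ≤ barrierDiffusion c T R y := by
  have hT0 : 0 < T := zero_lt_one.trans_le hT
  have hR0 : 0 < R := hT0.trans_le hTR
  have hC0 : 0 ≤ C := (abs_nonneg _).trans (hC 0).1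
  have hscale : C * c.delta / R ^ 2 ≤ C * c.delta / T := by
    gcongr
    nlinarith
  have hdiff := neg_le_diffusion_bump_div hC hδ hb hR0
    (le_max_right (y.2 + gamma c (max y.1 0)) R) hy
  have hpos : 0 ≤ C * c.delta / R ^ 2 := by positivity
  rw [barrierDiffusion]
  nlinarith [bump_nonneg (y.1 / T), bump_le_one (y.1 / T)]

theorem barrier_datum_le [Admissible c] {α : ℝ} (hα : 0 ≤ α)
    (hC : ∀ y, |deriv bump y| ≤ C ∧ |deriv (deriv bump) y| ≤ C) (hb : 0 ≤ c.b) (hT : 1 ≤ T)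
    (hTR : T ≤ R) (hγ : gamma c (2 * T) ≤ R) {y : ℝ × ℝ} (hy : y ∈ dom c) :
    α * barrier T R y - fderiv ℝ (barrier T R) y (1, 0) -
        c.sigma ^ 2 / 8 * barrierDiffusion c T R y ≤
      α + (C + c.sigma ^ 2 / 8 * (C * c.delta)) / T := by
  have hT0 : 0 < T := zero_lt_one.trans_le hT
  have hR0 : 0 < R := hT0.trans_le hTR
  have hδ := Admissible.one_le_delta (c := c)
  by_cases hbox : y ∈ barrierBox T R
  · have hx : -R ≤ y.2 :=
      (neg_le_neg ((gamma_mono hy.1 hbox.1.2).trans hγ)).trans hy.2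
    have hone : barrier T R y ≤ 1 :=
      mul_le_one₀ (bump_le_one _) (bump_nonneg _) (bump_le_one _)
    have htime := neg_le_of_abs_le (abs_fderiv_barrier_fst_le (fun z => (hC z).1) hT0 hR0 y)
    have hdiff := mul_le_mul_of_nonneg_left
      (neg_le_barrierDiffusion hC hδ hb hT hTR hx)
      (by positivity : 0 ≤ c.sigma ^ 2 / 8)
    rw [add_div, mul_div_assoc]
    linarith [mul_le_mul_of_nonneg_left hone hα]
  · have htime : fderiv ℝ (barrier T R) y (1, 0) = 0 := by
      rw [fderiv_barrier_fst hT0 hR0]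
      rcases two_le_abs_div_of_notMem_barrierBox hT0 hR0 hbox with ht | hx
      · rw [deriv_bump_eq_zero (Or.inr ht), zero_div, zero_mul]
      · rw [bump_eq_zero hx, mul_zero]
    have hC0 : 0 ≤ C := (abs_nonneg _).trans (hC 0).1
    rw [htime, barrier_eq_zero hT0 hR0 hbox, barrierDiffusion_eq_zero hT0 hR0 hbox, mul_zero,
      mul_zero, sub_zero, sub_zero]
    positivity

end BarrierBounds

/-! ### The barrier as a resolvent -/

section IntegrationByParts

theorem intervalIntegral_weight_mul_deriv {a q ψ ψ' v v' : ℝ → ℝ} {x₁ x₂ : ℝ}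
    (ha : ∀ x ∈ uIcc x₁ x₂, HasDerivAt a (a x * q x) x) (hq : ContinuousOn q (uIcc x₁ x₂))
    (hψ : ∀ x, HasDerivAt ψ (ψ' x) x) (hψ' : Continuous ψ') (hψ₁ : ψ x₁ = 0) (hψ₂ : ψ x₂ = 0)
    (hv : ∀ x, HasDerivAt v (v' x) x) (hv' : Continuous v') :
    ∫ x in x₁..x₂, a x * (ψ x * v' x) = -∫ x in x₁..x₂, a x * ((ψ' x + ψ x * q x) * v x) := by
  have hprod : ∀ x ∈ uIcc x₁ x₂,
      HasDerivAt (fun x => a x * ψ x) (a x * (ψ' x + ψ x * q x)) x := fun x hx =>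
    ((ha x hx).mul (hψ x)).congr_deriv (by ring)
  have ha_cont : ContinuousOn a (uIcc x₁ x₂) := fun x hx =>
    (ha x hx).continuousAt.continuousWithinAt
  have hψ_cont : Continuous ψ := continuous_iff_continuousAt.2 fun x => (hψ x).continuousAt
  have hint : IntervalIntegrable (fun x => a x * (ψ' x + ψ x * q x)) volume x₁ x₂ :=
    (ha_cont.mul (hψ'.continuousOn.add (hψ_cont.continuousOn.mul hq))).intervalIntegrable
  simpa only [hψ₁, hψ₂, mul_zero, zero_mul, sub_zero, zero_sub, mul_assoc] using
    intervalIntegral.integral_mul_deriv_eq_deriv_mul hprod (fun x _ => hv x) hint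
      (hv'.intervalIntegrable _ _)

theorem hasDerivAt_rpow_mul_exp {b r s x : ℝ} (h : 0 < x + s) :
    HasDerivAt (fun x => (x + s) ^ r * Real.exp (-(b * x ^ 2 / 2)))
      ((x + s) ^ r * Real.exp (-(b * x ^ 2 / 2)) * (r / (x + s) - b * x)) x := by
  have hpow := ((hasDerivAt_id x).add_const s).rpow_const (p := r) (Or.inl h.ne')
  have hsq : HasDerivAt (fun x => -(b * x ^ 2 / 2)) (-(b * x)) x :=
    (((hasDerivAt_pow 2 x).const_mul b).div_const 2).neg.congr_deriv (by push_cast; ring)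
  refine (hpow.mul hsq.exp).congr_deriv ?_
  rw [id_eq, Real.rpow_sub_one h.ne']
  field_simp
  ring

theorem integral_eq_intervalIntegral {f g : ℝ → ℝ} {a b : ℝ} (hab : a ≤ b)
    (hf : ∀ x, x ∉ Ioo a b → f x = 0) (hfg : ∀ x ∈ Ioo a b, f x = g x) :
    ∫ x, f x = ∫ x in a..b, g x := by
  rw [intervalIntegral.integral_of_le hab, integral_Ioc_eq_integral_Ioo,
    ← setIntegral_congr_fun measurableSet_Ioo hfg,
    setIntegral_eq_integral_of_forall_compl_eq_zero hf]

variable {c : Data} [Admissible c] {R : ℝ}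

theorem integral_dens_mul_of_annulus {t : ℝ} (ht : 0 ≤ t) (hR : 0 < R) (hγ : gamma c t ≤ R)
    (hl : c.lam 0 ≤ R) {φ : ℝ → ℝ} (hφ : ∀ x, |x / R| ≤ 1 ∨ 2 ≤ |x / R| → φ x = 0) :
    ∫ x, (dens c (t, x)).toReal * φ x = c.p * ∫ x in R..2 * R,
      (x + gamma c t) ^ (c.delta - 1) * Real.exp (-(c.b * x ^ 2 / 2)) * φ x := by
  rw [← intervalIntegral.integral_const_mul]
  refine integral_eq_intervalIntegral (by linarith) (fun x hx => ?_) fun x hx => ?_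
  · by_cases hd : (t, x) ∈ dom c
    · rw [hφ x, mul_zero]
      rw [abs_div, abs_of_pos hR, div_le_one hR, le_div_iff₀ hR]
      rcases le_or_gt x R with hle | hgt
      · exact Or.inl (abs_le.2 ⟨(neg_le_neg hγ).trans hd.2, hle⟩)
      · exact Or.inr ((not_lt.1 fun hlt => hx ⟨hgt, hlt⟩).trans (le_abs_self x))
    · rw [dens_of_notMem hd, ENNReal.toReal_zero, zero_mul]
  · have hγ0 := gamma_nonneg (c := c) ht
    have hpos : 0 < x + gamma c t := by linarith [hx.1]
    rw [dens_of_mem (y := (t, x)) ⟨ht, by linarith⟩, ENNReal.toReal_ofReal (rho_nonneg _ _),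
      rho_of_beta_le ((beta_le_lam_zero ht).trans (hl.trans hx.1.le)), abs_of_pos hpos]
    ring

variable {T : ℝ}

theorem integral_dens_mul_barrier (hT : 0 < T) (hR : 0 < R) (hγ : gamma c (2 * T) ≤ R)
    (hl : c.lam 0 ≤ R) (t : ℝ) {v v' : ℝ → ℝ} (hv : ∀ x, HasDerivAt v (v' x) x)
    (hv' : Continuous v') :
    ∫ x, (dens c (t, x)).toReal * (fderiv ℝ (barrier T R) (t, x) (0, 1) * v' x) =
      -∫ x, (dens c (t, x)).toReal * (barrierDiffusion c T R (t, x) * v x) := by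
  simp only [fderiv_barrier_snd hT hR]
  rcases lt_or_ge t 0 with ht | ht
  · have hdens (x : ℝ) : dens c (t, x) = 0 := dens_of_notMem fun h => h.1.not_gt ht
    simp only [hdens, ENNReal.toReal_zero, zero_mul, integral_zero, neg_zero]
  rcases le_or_gt (2 * T) t with htT | htT
  · have hbump : bump (t / T) = 0 :=
      bump_eq_zero (((le_div_iff₀ hT).2 htT).trans (le_abs_self _))
    simp only [barrierDiffusion, hbump, zero_mul, mul_zero, integral_zero, neg_zero]
  have hγt : gamma c t ≤ R := (gamma_mono ht htT.le).trans hγ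
  have hle : R ≤ 2 * R := by linarith
  have hpos : ∀ x ∈ uIcc R (2 * R), 0 < x + gamma c t := fun x hx => by
    rw [uIcc_of_le hle] at hx
    linarith [hx.1, gamma_nonneg (c := c) ht]
  rw [integral_dens_mul_of_annulus ht hR hγt hl fun x hx => by
      rw [deriv_bump_eq_zero hx, zero_div, mul_zero, zero_mul],
    integral_dens_mul_of_annulus ht hR hγt hl fun x hx => by
      rw [barrierDiffusion, deriv_bump_eq_zero hx, deriv_deriv_bump_eq_zero hx, zero_div, zero_div,
        zero_mul, add_zero, mul_zero, zero_mul], ← mul_neg]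
  rw [intervalIntegral_weight_mul_deriv
    (ψ' := fun x => bump (t / T) * (deriv (deriv bump) (x / R) / R / R))
    (fun x hx => hasDerivAt_rpow_mul_exp (hpos x hx))
    ((continuousOn_const.div (by fun_prop) fun x hx => (hpos x hx).ne').sub (by fun_prop))
    (fun x => (hasDerivAt_deriv_bump_div R x).const_mul (bump (t / T)))
    (by have := continuous_deriv_deriv_bump; fun_prop)
    (by rw [deriv_bump_eq_zero (by simp [hR.ne']), zero_div, mul_zero])
    (by rw [deriv_bump_eq_zero (by simp [hR.ne']), zero_div, mul_zero]) hv hv']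
  congr 2
  refine intervalIntegral.integral_congr fun x hx => ?_
  have hmax : max (x + gamma c (max t 0)) R = x + gamma c t := by
    rw [uIcc_of_le hle] at hx
    rw [max_eq_left ht, max_eq_left]
    linarith [hx.1, gamma_nonneg (c := c) ht]
  simp only [barrierDiffusion, hmax]
  ring

theorem integral_fderiv_barrier_mul (hT : 0 < T) (hR : 0 < R) (hγ : gamma c (2 * T) ≤ R)
    (hl : c.lam 0 ≤ R) {u : ℝ × ℝ → ℝ} (hu : IsC01 u) :
    ∫ y, fderiv ℝ (barrier T R) y (0, 1) * fderiv ℝ u y (0, 1) ∂refMeasure c =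
      -∫ y, barrierDiffusion c T R y * u y ∂refMeasure c := by
  have hw := isC01_barrier hT hR
  have hint : Integrable (fun y => fderiv ℝ (barrier T R) y (0, 1) * fderiv ℝ u y (0, 1))
      (refMeasure c) :=
    ((hw.continuous_fderiv _).mul (hu.continuous_fderiv _)).integrable_of_hasCompactSupport
      (hw.hasCompactSupport_fderiv _).mul_right
  have hint' : Integrable (fun y => barrierDiffusion c T R y * u y) (refMeasure c) :=
    ((continuous_barrierDiffusion hR).mul hu.1.continuous).integrable_of_hasCompactSupport
      (hasCompactSupport_barrierDiffusion hT hR).mul_right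
  rw [integral_refMeasure hint, integral_refMeasure hint', ← integral_neg]
  refine integral_congr_ae (ae_of_all _ fun t => ?_)
  exact integral_dens_mul_barrier hT hR hγ hl t (v := fun x => u (t, x))
    (fun x => hu.hasDerivAt_snd (t, x)) ((hu.continuous_fderiv _).comp (by fun_prop))

end IntegrationByParts

section ClassicalResolvent

variable {c : Data}

theorem inner_dx_eq_of_isC01 {D L : H c} {g ℓ : ℝ × ℝ → ℝ} (hD : D =ᵐ[refMeasure c] g)
    (hL : L =ᵐ[refMeasure c] ℓ) (hibp : ∀ u, IsC01 u →
      ∫ y, g y * fderiv ℝ u y (0, 1) ∂refMeasure c = -∫ y, ℓ y * u y ∂refMeasure c) (v : V c) :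
    inner ℝ D (dx c v) = -inner ℝ L (toH c v) := by
  have hclosed : IsClosed {v : WithLp 2 (H c × H c) | inner ℝ D v.snd = -inner ℝ L v.fst} :=
    isClosed_eq (continuous_const.inner (WithLp.continuous_snd 2 _ _))
      (continuous_const.inner (WithLp.continuous_fst 2 _ _)).neg
  refine closure_minimal ?_ hclosed v.2
  rintro w ⟨u, hu, hfst, hsnd⟩
  have hDw : ∫ y, D y * w.snd y ∂refMeasure c =
      ∫ y, g y * fderiv ℝ u y (0, 1) ∂refMeasure c := by
    refine integral_congr_ae ?_
    filter_upwards [hD, hsnd] with y hDy hy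
    rw [hDy, hy, (hu.hasDerivAt_snd y).deriv]
  have hLw : ∫ y, L y * w.fst y ∂refMeasure c = ∫ y, ℓ y * u y ∂refMeasure c :=
    integral_congr_ae (hL.mul hfst)
  rw [mem_ofPred_eq, inner_eq_integral, inner_eq_integral, hDw, hLw, hibp u hu]

theorem isResolvent_of_isC01 [IsTranslationSubinvariant (refMeasure c)]
    [IsFiniteMeasureOnCompacts (refMeasure c)] (α : ℝ) {u ℓ : ℝ × ℝ → ℝ} (hu : IsC01 u)
    (hℓ : MemLp ℓ 2 (refMeasure c)) (hibp : ∀ v, IsC01 v →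
      ∫ y, fderiv ℝ u y (0, 1) * fderiv ℝ v y (0, 1) ∂refMeasure c =
        -∫ y, ℓ y * v y ∂refMeasure c) {f w : H c} (hw : w =ᵐ[refMeasure c] u)
    (hf : f =ᵐ[refMeasure c] fun y =>
      α * u y - fderiv ℝ u y (1, 0) - c.sigma ^ 2 / 8 * ℓ y) :
    IsResolvent c α f w := by
  have hmem (v : ℝ × ℝ) : MemLp (fun y => fderiv ℝ u y v) 2 (refMeasure c) :=
    (hu.continuous_fderiv v).memLp_of_hasCompactSupport (hu.hasCompactSupport_fderiv v)
  set K : H c := (hmem (1, 0)).toLp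
  set D : H c := (hmem (0, 1)).toLp
  set L : H c := hℓ.toLp
  have hfw : f = α • w - K - (c.sigma ^ 2 / 8) • L := by
    refine Lp.ext (hf.trans ?_)
    filter_upwards [hw, (hmem (1, 0)).coeFn_toLp, hℓ.coeFn_toLp,
      Lp.coeFn_sub (α • w - K) ((c.sigma ^ 2 / 8) • L), Lp.coeFn_sub (α • w) K,
      Lp.coeFn_smul α w, Lp.coeFn_smul (c.sigma ^ 2 / 8) L] with y hwy hK hL h₁ h₂ h₃ h₄
    rw [h₁, Pi.sub_apply, h₂, Pi.sub_apply, h₃, h₄, Pi.smul_apply, Pi.smul_apply, hwy, hK, hL,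
      smul_eq_mul, smul_eq_mul]
  have hV : WithLp.toLp 2 (w, D) ∈ V c := by
    refine (gradGraph c).le_topologicalClosure ⟨u, hu, hw, ?_⟩
    filter_upwards [(hmem (0, 1)).coeFn_toLp] with y hD
    exact hD.trans (hu.hasDerivAt_snd y).deriv.symm
  refine ⟨(⟨_, hV⟩, (innerSL ℝ K).comp (toHL c)),
    subset_closure ⟨K, hasTimeDeriv_of_isC01 hu hw (hmem (1, 0)).coeFn_toLp, fun _ => rfl⟩, rfl,
    fun v => ?_⟩
  have hD := inner_dx_eq_of_isC01 (hmem (0, 1)).coeFn_toLp hℓ.coeFn_toLp hibp v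
  change c.sigma ^ 2 / 8 * inner ℝ D (dx c v) - inner ℝ K (toH c v) + α * inner ℝ w (toH c v) = _
  rw [hD, hfw, inner_sub_left, inner_sub_left, real_inner_smul_left, real_inner_smul_left]
  ring

end ClassicalResolvent

/-! ### Conservativity -/

section Conservativity

variable {c : Data}

theorem tendsto_inf_of_increasesTo {a : ℕ → H c} {g : ℝ × ℝ → ℝ} (ha : IncreasesTo c a g)
    {f : H c} (hf : ∀ᵐ y ∂refMeasure c, f y ≤ g y) :
    Tendsto (fun n => a n ⊓ f) atTop (𝓝 f) := by
  refine tendsto_Lp_of_dominated (f := fun n y => a n y ⊓ f y) (f₀ := f) ENNReal.ofNat_ne_top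
    (Lp.memLp f).norm (fun n => Lp.coeFn_inf _ _) EventuallyEq.rfl ?_ ?_
  · refine Eventually.of_forall fun n => ?_
    filter_upwards [ha] with y hy
    rw [norm_sub_rev, Real.norm_of_nonneg (sub_nonneg.2 inf_le_right), Real.norm_eq_abs]
    rcases le_total (a n y) (f y) with h | h
    · rw [inf_of_le_left h]
      linarith [le_abs_self (f y), hy.1 n]
    · rw [inf_of_le_right h, sub_self]
      exact abs_nonneg _
  · filter_upwards [ha, hf] with y hy hfg
    simpa only [inf_of_le_right hfg] using hy.2.2.inf_nhds (tendsto_const_nhds (x := f y))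

variable [Admissible c] {α : ℝ}

theorem exists_isResolvent_barrier {T R C : ℝ} (hα : 0 ≤ α)
    (hC : ∀ y, |deriv bump y| ≤ C ∧ |deriv (deriv bump) y| ≤ C) (hb : 0 ≤ c.b) (hT : 1 ≤ T)
    (hTR : T ≤ R) (hγ : gamma c (2 * T) ≤ R) (hl : c.lam 0 ≤ R) :
    ∃ f w : H c, IsResolvent c α f w ∧ w =ᵐ[refMeasure c] barrier T R ∧
      ∀ᵐ y ∂refMeasure c, f y ≤ α + (C + c.sigma ^ 2 / 8 * (C * c.delta)) / T := by
  have hT0 : 0 < T := zero_lt_one.trans_le hT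
  have hR0 : 0 < R := hT0.trans_le hTR
  have hw := isC01_barrier hT0 hR0
  have hw_mem : MemLp (barrier T R) 2 (refMeasure c) :=
    hw.1.continuous.memLp_of_hasCompactSupport hw.2
  have htime : MemLp (fun y => fderiv ℝ (barrier T R) y (1, 0)) 2 (refMeasure c) :=
    (hw.continuous_fderiv _).memLp_of_hasCompactSupport (hw.hasCompactSupport_fderiv _)
  have hdiff : MemLp (barrierDiffusion c T R) 2 (refMeasure c) :=
    (continuous_barrierDiffusion hR0).memLp_of_hasCompactSupport
      (hasCompactSupport_barrierDiffusion hT0 hR0)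
  have hf := ((hw_mem.const_mul α).sub htime).sub (hdiff.const_mul (c.sigma ^ 2 / 8))
  refine ⟨hf.toLp, hw_mem.toLp, isResolvent_of_isC01 α hw hdiff
    (fun v hv => integral_fderiv_barrier_mul hT0 hR0 hγ hl hv) hw_mem.coeFn_toLp hf.coeFn_toLp,
    hw_mem.coeFn_toLp, ?_⟩
  filter_upwards [hf.coeFn_toLp, ae_mem_dom c] with y hy hdom
  exact hy.trans_le (barrier_datum_le hα hC hb hT hTR hγ hdom)

theorem ae_le_of_forall_resolvent_le (hσ : 0 < c.sigma) (hα : 0 < α) {a : ℕ → H c}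
    {g : ℝ × ℝ → ℝ} (ha : IncreasesTo c a g) {f w : H c} (h : IsResolvent c α f w)
    (hf : ∀ᵐ y ∂refMeasure c, f y ≤ g y) :
    ∀ᵐ y ∂refMeasure c, ∀ M, (∀ n, resolvent c α (a n) y ≤ M) → w y ≤ M := by
  have hlim : Tendsto (fun n => resolvent c α (a n ⊓ f)) atTop (𝓝 w) := by
    rw [h.unique hα (isResolvent_resolvent hσ hα f)]
    exact ((lipschitzWith_resolvent hσ hα).continuous.tendsto f).comp
      (tendsto_inf_of_increasesTo ha hf)
  obtain ⟨ns, -, hns⟩ := (tendstoInMeasure_of_tendsto_Lp hlim).exists_seq_tendsto_ae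
  have hle : ∀ᵐ y ∂refMeasure c, ∀ n, resolvent c α (a n ⊓ f) y ≤ resolvent c α (a n) y := by
    refine ae_all_iff.2 fun n => ?_
    refine (isResolvent_resolvent hσ hα _).ae_mono hα (isResolvent_resolvent hσ hα _) ?_
    filter_upwards [Lp.coeFn_inf (a n) f] with y hy
    exact hy.trans_le inf_le_left
  filter_upwards [hns, hle] with y hy hley M hM
  exact le_of_tendsto' hy fun k => (hley _).trans (hM _)

theorem ae_le_mul_of_forall_resolvent_le (hσ : 0 < c.sigma) (hα : 0 < α) {a : ℕ → H c}
    (ha : IncreasesTo c a (oneE c)) {κ : ℝ} (hκ : 0 < κ) {f w : H c} (h : IsResolvent c α f w)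
    (hf : ∀ᵐ y ∂refMeasure c, f y ≤ κ) :
    ∀ᵐ y ∂refMeasure c, ∀ M, (∀ n, resolvent c α (a n) y ≤ M) → w y ≤ κ * M := by
  have hf_one : ∀ᵐ y ∂refMeasure c, (κ⁻¹ • f : H c) y ≤ oneE c y := by
    filter_upwards [hf, Lp.coeFn_smul κ⁻¹ f, ae_mem_dom c] with y hfy hy hdom
    rw [hy, Pi.smul_apply, smul_eq_mul, oneE, indicator_of_mem hdom]
    exact inv_mul_le_one_of_le₀ hfy hκ.le
  filter_upwards [ae_le_of_forall_resolvent_le hσ hα ha (h.smul κ⁻¹) hf_one,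
    Lp.coeFn_smul κ⁻¹ w] with y hle hy M hM
  have hwM := hle M hM
  rwa [hy, Pi.smul_apply, smul_eq_mul, inv_mul_le_iff₀ hκ] at hwM

theorem ae_one_le_of_forall_resolvent_le (hσ : 0 < c.sigma) (hb : 0 ≤ c.b) (hα : 0 < α)
    {a : ℕ → H c} (ha : IncreasesTo c a (oneE c)) :
    ∀ᵐ y ∂refMeasure c, ∀ M, (∀ n, resolvent c α (a n) y ≤ M) → 1 ≤ α * M := by
  obtain ⟨C, hC⟩ := exists_bound_deriv_bump
  set D : ℝ := C + c.sigma ^ 2 / 8 * (C * c.delta)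
  have hD : 0 ≤ D := by
    have hC0 : 0 ≤ C := (abs_nonneg _).trans (hC 0).1
    have hδ := Admissible.one_le_delta (c := c)
    positivity
  set T : ℕ → ℝ := fun k => k + 1
  set R : ℕ → ℝ := fun k => max (T k) (max (gamma c (2 * T k)) (c.lam 0))
  have hT : ∀ k, 1 ≤ T k := fun k => le_add_of_nonneg_left k.cast_nonneg
  have hTR : ∀ k, T k ≤ R k := fun k => le_max_left _ _
  have hT_lim : Tendsto T atTop atTop :=
    tendsto_atTop_add_const_right _ _ tendsto_natCast_atTop_atTop
  have hbarrier : ∀ᵐ y ∂refMeasure c, ∀ k, ∀ M, (∀ n, resolvent c α (a n) y ≤ M) →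
      barrier (T k) (R k) y ≤ (α + D / T k) * M := by
    refine ae_all_iff.2 fun k => ?_
    obtain ⟨f, w, hfw, hw, hf⟩ := exists_isResolvent_barrier (c := c) hα.le hC hb (hT k) (hTR k)
      ((le_max_left _ _).trans (le_max_right _ _)) ((le_max_right _ _).trans (le_max_right _ _))
    have hκ : 0 < α + D / T k :=
      add_pos_of_pos_of_nonneg hα (div_nonneg hD (zero_le_one.trans (hT k)))
    filter_upwards [ae_le_mul_of_forall_resolvent_le hσ hα ha hκ hfw hf, hw] with y hy hwy
    rwa [← hwy]
  filter_upwards [hbarrier] with y hy M hM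
  have hlim : Tendsto (fun k => (α + D / T k) * M) atTop (𝓝 (α * M)) := by
    simpa only [add_zero] using ((hT_lim.const_div_atTop D).const_add α).mul_const M
  refine ge_of_tendsto hlim ?_
  filter_upwards [hT_lim.eventually_ge_atTop (max |y.1| |y.2|)] with k hk
  have hT0 : 0 < T k := zero_lt_one.trans_le (hT k)
  rw [← barrier_eq_one hT0 (hT0.trans_le (hTR k)) ((le_max_left _ _).trans hk)
    ((le_max_right _ _).trans (hk.trans (hTR k)))]
  exact hy k M hM

theorem exists_increasesTo_oneE : ∃ a : ℕ → H c, IncreasesTo c a (oneE c) := by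
  set B : ℕ → Set (ℝ × ℝ) := fun n => Metric.closedBall 0 n
  have hB (n : ℕ) : refMeasure c (B n) ≠ ⊤ := measure_closedBall_lt_top.ne
  refine ⟨fun n => indicatorConstLp 2 Metric.isClosed_closedBall.measurableSet (hB n) 1, ?_⟩
  have hcoe : ∀ᵐ y ∂refMeasure c, ∀ n, indicatorConstLp 2
      Metric.isClosed_closedBall.measurableSet (hB n) (1 : ℝ) y = (B n).indicator (fun _ => 1) y :=
    ae_all_iff.2 fun n => indicatorConstLp_coeFn
  filter_upwards [hcoe, ae_mem_dom c] with y hy hdom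
  simp only [hy]
  refine ⟨fun n => indicator_nonneg (fun _ _ => zero_le_one) _, fun m n hmn => ?_, ?_⟩
  · exact indicator_le_indicator_of_subset
      (Metric.closedBall_subset_closedBall (Nat.cast_le.2 hmn)) (fun _ => zero_le_one) y
  · obtain ⟨N, hN⟩ := exists_nat_ge (dist y 0)
    refine tendsto_const_nhds.congr' ?_
    filter_upwards [eventually_ge_atTop N] with n hn
    rw [oneE, indicator_of_mem hdom, indicator_of_mem]
    exact hN.trans (Nat.cast_le.2 hn)

theorem extendsTo_oneE (hσ : 0 < c.sigma) (hb : 0 ≤ c.b) (hα : 0 < α) :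
    ExtendsTo c (fun f => α • resolvent c α f) (oneE c) (oneE c) := by
  refine ⟨exists_increasesTo_oneE, fun a ha => ?_⟩
  have hmono : ∀ᵐ y ∂refMeasure c, ∀ n, resolvent c α (a n) y ≤ resolvent c α (a (n + 1)) y := by
    refine ae_all_iff.2 fun n => (isResolvent_resolvent hσ hα _).ae_mono hα
      (isResolvent_resolvent hσ hα _) ?_
    filter_upwards [ha] with y hy
    exact hy.2.1 n.le_succ
  have hle : ∀ᵐ y ∂refMeasure c, ∀ n, resolvent c α (a n) y ≤ α⁻¹ := by
    refine ae_all_iff.2 fun n => (isResolvent_resolvent hσ hα _).ae_le hα (inv_pos.2 hα).le ?_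
    filter_upwards [ha, ae_mem_dom c] with y hy hdom
    rw [mul_inv_cancel₀ hα.ne']
    simpa only [oneE, indicator_of_mem hdom] using hy.2.1.ge_of_tendsto hy.2.2 n
  have hcoe : ∀ᵐ y ∂refMeasure c, ∀ n,
      (α • resolvent c α (a n) : H c) y = α * resolvent c α (a n) y :=
    ae_all_iff.2 fun n => Lp.coeFn_smul _ _
  filter_upwards [hmono, hle, ae_one_le_of_forall_resolvent_le hσ hb hα ha, ae_mem_dom c, hcoe]
    with y hmono hle hone hdom hcoe
  have hlub : IsLUB (range fun n => resolvent c α (a n) y) α⁻¹ :=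
    ⟨forall_mem_range.2 hle, fun M hM =>
      (inv_le_iff_one_le_mul₀' hα).2 (hone M (forall_mem_range.1 hM))⟩
  have hmono' := monotone_nat_of_le_succ hmono
  simp only [hcoe]
  refine ⟨hmono'.const_mul hα.le, ?_⟩
  rw [oneE, indicator_of_mem hdom, ← mul_inv_cancel₀ hα.ne']
  exact (tendsto_atTop_isLUB hmono' hlub).const_mul α

end Conservativity

section WeakDerivative

/-- `φ'` is the weak derivative on `(0, ∞)` of the function `φ`, continuous on `[0, ∞)`, and it lies
in `L¹_loc([0, ∞))`: the hypothesis on the moving boundary in `mainTheorem5_general`. -/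
def IsWeakDerivL1loc (φ φ' : ℝ → ℝ) : Prop :=
  ContinuousOn φ (Ici 0) ∧ (∀ T : ℝ, IntegrableOn φ' (Icc 0 T)) ∧
    ∀ f : ℝ → ℝ, IsC01 f → tsupport f ⊆ Ioi 0 →
      ∫ x in Ioi (0 : ℝ), φ x * deriv f x = -∫ x in Ioi (0 : ℝ), φ' x * f x

theorem IsWeakDerivL2loc.isWeakDerivL1loc {φ φ' : ℝ → ℝ} (h : IsWeakDerivL2loc φ φ')
    (hφ : ContinuousOn φ (Ici 0)) : IsWeakDerivL1loc φ φ' :=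
  ⟨hφ, fun T => (h.1 T).integrable one_le_two, h.2⟩

end WeakDerivative

end

end MovingDomain

theorem mainTheorem5_general (c : MovingDomain.Data)
    (hsigma : 0 < c.sigma) (hdelta : 1 ≤ c.delta) (hb : 0 ≤ c.b) (hp0 : 0 ≤ c.p) (hp1 : c.p ≤ 1)
    (hdlam : MovingDomain.IsWeakDerivL1loc c.lam c.dlam)
    (hrho : MovingDomain.RhoMonotone c) :
    (∀ α : ℝ, 0 < α → ∀ f : MovingDomain.H c, ∃! g, MovingDomain.IsResolvent c α f g) ∧
    (∀ α : ℝ, 0 < α →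
      MovingDomain.IsSubMarkovian c (fun f => α • MovingDomain.resolvent c α f) ∧
      MovingDomain.ExtendsTo c (fun f => α • MovingDomain.resolvent c α f)
        (MovingDomain.oneE c) (MovingDomain.oneE c)) ∧
    MovingDomain.ExtendsTo c (MovingDomain.resolvent c 1)
      (MovingDomain.oneE c) (MovingDomain.oneE c) := by
  have : MovingDomain.Admissible c := ⟨hdelta, hp0, hp1, hdlam.2.1, hrho⟩
  refine ⟨fun α hα f => MovingDomain.existsUnique_isResolvent hsigma hα f, fun α hα =>
    ⟨MovingDomain.isSubMarkovian_smul_resolvent hsigma hα,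
      MovingDomain.extendsTo_oneE hsigma hb hα⟩, ?_⟩
  simpa only [one_smul] using MovingDomain.extendsTo_oneE (c := c) hsigma hb zero_lt_one

theorem mainTheorem5 (c : MovingDomain.Data)
    (hsigma : 0 < c.sigma) (hdelta : 1 ≤ c.delta) (hb : 0 ≤ c.b) (hp0 : 0 < c.p) (hp1 : c.p < 1)
    (hlam : MovingDomain.MemH12loc c.lam) (hlam0 : ∀ t, 0 ≤ t → 0 ≤ c.lam t)
    (hdlam : MovingDomain.IsWeakDerivL2loc c.lam c.dlam)
    (hrho : MovingDomain.RhoMonotone c) :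
    (∀ α : ℝ, 0 < α → ∀ f : MovingDomain.H c, ∃! g, MovingDomain.IsResolvent c α f g) ∧
    (∀ α : ℝ, 0 < α →
      MovingDomain.IsSubMarkovian c (fun f => α • MovingDomain.resolvent c α f) ∧
      MovingDomain.ExtendsTo c (fun f => α • MovingDomain.resolvent c α f)
        (MovingDomain.oneE c) (MovingDomain.oneE c)) ∧
    MovingDomain.ExtendsTo c (MovingDomain.resolvent c 1)
      (MovingDomain.oneE c) (MovingDomain.oneE c) :=
  mainTheorem5_general c hsigma hdelta hb hp0.le hp1.le (hdlam.isWeakDerivL1loc hlam.1) hrho
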